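/- Conventions. A convex polygonal region is a closed subset of the plane with non-empty interior that is the intersection of finitely many closed half-planes (it may be unbounded). A diagonal of such a region is a (non-degenerate) segment joining two points of its boundary. For $u\ne v$, the closed half-plane to the right of the line $uv$ directed from $u$ to $v$ is denoted by $\mathrm{right}(uv)$. Vertices of convex polygons are listed in clockwise order, and a set of points is in general position if no three distinct points of it are collinear. Let $Q$ be a convex polygonal region with a non-empty boundary and let $a$ be a point of the boundary of $Q$. Let $s\ge 1$ be an integer and let $p_1,\dots,p_{s+1}$ be points of $Q$ such that $p_1$ and $p_{s+1}$ lie on the boundary of $Q$, $a\in \mathrm{right}(p_1p_{s+1})$, and $(a,p_1,\dots,p_{s+1})$ is a convex polygon, where the cases $a=p_1$ and $a=p_{s+1}$ are also allowed (then the polygon is $(p_1,\dots,p_{s+1})$, which for $s=1$ is just a segment). Let $P$ be the convex region enclosed by the chain $p_1p_2,\dots,p_sp_{s+1}$ and by the boundary of $Q$ traversed clockwise from $p_{s+1}$ through $a$ to $p_1$, that is, $P=Q\cap\bigcap_{i=1}^{s}\mathrm{right}(p_ip_{i+1})$. Let $B$ be a finite set of blue points in $P$, none of which is equal to $a$ or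 to any $p_i$, and let $R$ be a finite set of red points in $Q\setminus P$, such that $|B|-|R|=s$ and $R\cup B\cup\{a,p_1,\dots,p_{s+1}\}$ is in general position. Then there exist convex polygonal regions $Q_1,\dots,Q_s$ with pairwise disjoint interiors whose union is $Q$, and an assignment of every point of $B\cup R$ to exactly one of the regions $Q_i$ that contain it, such that for every $i$ the segment $p_ip_{i+1}$ is a diagonal of $Q_i$ and the number of blue points assigned to $Q_i$ minus the number of red points assigned to $Q_i$ is equal to $1$. -/

import Mathlib

namespace ChainPartition

/-- The Euclidean plane. -/
abbrev Plane : Type := EuclideanSpace ℝ (Fin 2)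

/-- Twice the signed area of the triangle `u v x`: positive if `u, v, x` is a counterclockwise turn,
negative if it is a clockwise turn, and zero if the three points are collinear. -/
def orient (u v x : Plane) : ℝ :=
  (v 0 - u 0) * (x 1 - u 1) - (v 1 - u 1) * (x 0 - u 0)

/-- The closed half-plane to the right of the line through `u` and `v`, directed from `u` to `v`
(used for `u ≠ v`). -/
def rightHalfPlane (u v : Plane) : Set Plane :=
  {x | orient u v x ≤ 0}

/-- A convex polygonal region: an intersection of finitely many closed half-planes (possibly
unbounded, possibly the whole plane) that has interior points. -/
def IsConvexPolygonalRegion (Q : Set Plane) : Prop :=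
  (∃ H : Finset (Plane × Plane), (∀ h ∈ H, h.1 ≠ h.2) ∧ Q = ⋂ h ∈ H, rightHalfPlane h.1 h.2) ∧
    (interior Q).Nonempty

/-- The points `v 0, …, v (n - 1)` are distinct and are, in clockwise order, the vertices of a
(strictly) convex polygon. For two points this is a segment, regarded as a degenerate polygon. -/
def IsClockwiseConvexPolygon {n : ℕ} (v : Fin n → Plane) : Prop :=
  Function.Injective v ∧ ∀ i j k : Fin n, i < j → j < k → orient (v i) (v j) (v k) < 0

/-- No three distinct points of `S` lie on a line. -/
def InGeneralPosition (S : Set Plane) : Prop :=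
  ∀ x ∈ S, ∀ y ∈ S, ∀ z ∈ S, x ≠ y → y ≠ z → x ≠ z → ¬ Collinear ℝ {x, y, z}

/-- The segment `xy` is a diagonal of the region `Q`: it joins two points of the boundary of `Q`. -/
def IsDiagonal (x y : Plane) (Q : Set Plane) : Prop :=
  x ≠ y ∧ x ∈ frontier Q ∧ y ∈ frontier Q

/-- The part of `Q` that the chain `p 0, p 1, …, p s` cuts off on its right. If `Q` is a convex
polygonal region that contains the chain, the ends of the chain lie on the boundary of `Q`, and the
chain is convex (it makes clockwise turns), then this is the convex region enclosed by the chain and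
by the boundary of `Q` traversed clockwise from `p s` to `p 0`: that region is convex and has
every `p i, p (i + 1)` as an edge, with the region to the right of it. -/
def enclosedRegion {s : ℕ} (Q : Set Plane) (p : Fin (s + 1) → Plane) : Set Plane :=
  {x | x ∈ Q ∧ ∀ i : Fin s, x ∈ rightHalfPlane (p i.castSucc) (p i.succ)}

/-- The regions `Qs i` form a partition of `Q` into convex polygonal regions: they cover `Q`
exactly, and distinct ones have no common interior point. -/
def IsConvexPartition {s : ℕ} (Q : Set Plane) (Qs : Fin s → Set Plane) : Prop :=
  (∀ i, IsConvexPolygonalRegion (Qs i)) ∧ (⋃ i, Qs i) = Q ∧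
    ∀ i j, i ≠ j → Disjoint (interior (Qs i)) (interior (Qs j))

end ChainPartition

open ChainPartition

/-!
Write `w = 1` for blue and `w = -1` for red points, so that each region has to receive weight `1`.
The apex `a` stays fixed, and the chain `p m, …, p n` inside a convex region `Q` that contains
points of total weight `n - m` is treated by induction on `n - m` (`IsPiece.splits`). Every step cuts `Q`
into convex parts, each with `a` and its own part of the chain on it, or with a single edge.

Let `f i` be the weight to the left of the line from `a` to the inner vertex `p i`, minus its
required value `i - m`.

* If some `f i` vanishes, cut along that line (`IsPiece.splits_of_leftWeight_eq`).
* If `f (m + 1) > 0`, rotate a line about `p (m + 1)` from the edge `p m, p (m + 1)`, which has no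
  blue point to its left, to the line from `a`. General position makes the weight to the left
  change in steps of one, so that it is `1` at some moment (`IsPiece.splits_of_lt_leftWeight`). The
  case `f (n - 1) < 0` is the mirror image (`IsPiece.splits_of_leftWeight_lt`).
* Otherwise `f i < 0 < f (i + 1)` for some `i`, and there is a point `c` in the triangle
  `a, p i, p (i + 1)` such that the rays from `c` to the three vertices cut `Q` into parts of
  the required weights (`IsPiece.splits_of_leftWeight_lt_of_lt`).

The last case is a two-dimensional intermediate value statement, `ThreeWayData.exists_cut`. It needs
no fixed point theorem, because the weight opposite to `p i` is monotone along each ray from `p i`: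
no red point lies in the triangle, and no blue point beyond the edge `p i, p (i + 1)`. Hence the
positions of `c` for which this weight is right meet each such ray in an interval, and two
connectedness arguments, along a ray and over all rays, give a position where the other two weights
are right as well. Points on a cut may be assigned to either side, which turns all the sets of
positions into closed sets; since a cut contains at most one point, two assignments at the same
position on either side of the required value can be mixed to attain it.
-/

open ChainPartition
open Filter Topology

namespace ChainPartition

/-! ### Signed areas -/

lemma orient_swap (u v x : Plane) : orient v u x = -orient u v x := by
  simp only [orient]; ring

lemma orient_swap_right (u v x : Plane) : orient u x v = -orient u v x := by
  simp only [orient]; ring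

lemma orient_rotate (u v x : Plane) : orient v x u = orient u v x := by
  simp only [orient]; ring

lemma orient_self_left (u x : Plane) : orient u u x = 0 := by
  simp only [orient]; ring

lemma orient_self_right (u x : Plane) : orient u x x = 0 := by
  simp only [orient]; ring

lemma orient_self_outer (u x : Plane) : orient u x u = 0 := by
  simp only [orient]; ring

lemma orient_lineMap_left (t : ℝ) (u v y x : Plane) :
    orient ((1 - t) • u + t • v) y x = (1 - t) * orient u y x + t * orient v y x := by
  simp only [orient, PiLp.add_apply, PiLp.smul_apply, smul_eq_mul]; ring

lemma orient_lineMap_mid (t : ℝ) (u v y x : Plane) :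
    orient y ((1 - t) • u + t • v) x = (1 - t) * orient y u x + t * orient y v x := by
  simp only [orient, PiLp.add_apply, PiLp.smul_apply, smul_eq_mul]; ring

lemma orient_add_orient_add_orient (u v x y : Plane) :
    orient u v y + orient v x y + orient x u y = orient u v x := by
  simp only [orient]; ring

/-- Barycentric expansion of `y` with respect to `u, v, x`, tested against the line `k l`. -/
lemma orient_barycentric (u v x y k l : Plane) :
    orient u v x * orient k l y =
      orient v x y * orient k l u + orient x u y * orient k l v + orient u v y * orient k l x := by
  simp only [orient]; ring

lemma plane_ext {u v : Plane} (h0 : u 0 = v 0) (h1 : u 1 = v 1) : u = v := by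
  ext i; fin_cases i <;> assumption

lemma sq_add_sq_pos_of_ne {u v : Plane} (h : u ≠ v) :
    0 < (v 0 - u 0) ^ 2 + (v 1 - u 1) ^ 2 := by
  rcases eq_or_ne (u 0) (v 0) with h0 | h0
  · have h1 : u 1 ≠ v 1 := fun h1 => h (plane_ext h0 h1)
    have : 0 < (v 1 - u 1) ^ 2 := by
      have := sub_ne_zero.2 h1.symm
      positivity
    nlinarith [sq_nonneg (v 0 - u 0)]
  · have : 0 < (v 0 - u 0) ^ 2 := by
      have := sub_ne_zero.2 h0.symm
      positivity
    nlinarith [sq_nonneg (v 1 - u 1)]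

lemma collinear_of_orient_eq_zero {u v x : Plane} (huv : u ≠ v) (h : orient u v x = 0) :
    Collinear ℝ {u, v, x} := by
  have hpos := sq_add_sq_pos_of_ne huv
  rw [collinear_iff_of_mem (p₀ := u) (by simp)]
  refine ⟨v - u, ?_⟩
  intro y hy
  simp only [Set.mem_insert_iff, Set.mem_singleton_iff] at hy
  rcases hy with rfl | rfl | rfl
  · exact ⟨0, by simp⟩
  · exact ⟨1, by simp⟩
  · refine ⟨((y 0 - u 0) * (v 0 - u 0) + (y 1 - u 1) * (v 1 - u 1)) /
      ((v 0 - u 0) ^ 2 + (v 1 - u 1) ^ 2), ?_⟩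
    simp only [orient] at h
    apply plane_ext <;>
      simp only [vadd_eq_add, PiLp.add_apply, PiLp.smul_apply, smul_eq_mul, PiLp.sub_apply] <;>
      field_simp
    · linear_combination (-(v 1 - u 1)) * h
    · linear_combination (v 0 - u 0) * h

lemma continuous_orient (u v : Plane) : Continuous (orient u v) := by
  unfold orient; fun_prop

/-! ### Convex polygonal regions -/

lemma mem_rightHalfPlane {u v x : Plane} : x ∈ rightHalfPlane u v ↔ orient u v x ≤ 0 := Iff.rfl

lemma isClosed_rightHalfPlane (u v : Plane) : IsClosed (rightHalfPlane u v) :=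
  isClosed_le (continuous_orient u v) continuous_const

lemma convex_rightHalfPlane (u v : Plane) : Convex ℝ (rightHalfPlane u v) := by
  intro x hx y hy a b ha hb hab
  rw [mem_rightHalfPlane] at *
  have : orient u v (a • x + b • y) = a * orient u v x + b * orient u v y := by
    obtain rfl : b = 1 - a := by linarith
    simp only [orient, PiLp.add_apply, PiLp.smul_apply, smul_eq_mul]; ring
  rw [this]
  nlinarith

lemma IsConvexPolygonalRegion.convex {Q : Set Plane} (hQ : IsConvexPolygonalRegion Q) :
    Convex ℝ Q := by
  obtain ⟨⟨H, -, rfl⟩, -⟩ := hQ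
  exact convex_iInter₂ fun _ _ => convex_rightHalfPlane _ _

lemma IsConvexPolygonalRegion.isClosed {Q : Set Plane} (hQ : IsConvexPolygonalRegion Q) :
    IsClosed Q := by
  obtain ⟨⟨H, -, rfl⟩, -⟩ := hQ
  exact isClosed_biInter fun _ _ => isClosed_rightHalfPlane _ _

/-- A point of the open triangle `u v x` lies in the interior of every convex set containing the
vertices. -/
lemma mem_interior_of_orient_neg {Q : Set Plane} (hQ : Convex ℝ Q) {u v x y : Plane}
    (hu : u ∈ Q) (hv : v ∈ Q) (hx : x ∈ Q) (h₁ : orient u v y < 0) (h₂ : orient v x y < 0)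
    (h₃ : orient x u y < 0) : y ∈ interior Q := by
  rw [mem_interior]
  refine ⟨{z | orient u v z < 0} ∩ {z | orient v x z < 0} ∩ {z | orient x u z < 0}, ?_,
    ((isOpen_lt (continuous_orient _ _) continuous_const).inter
      (isOpen_lt (continuous_orient _ _) continuous_const)).inter
      (isOpen_lt (continuous_orient _ _) continuous_const), ⟨⟨h₁, h₂⟩, h₃⟩⟩
  rintro z ⟨⟨h1, h2⟩, h3⟩
  simp only [Set.mem_ofPred_eq] at h1 h2 h3
  have hD := orient_add_orient_add_orient u v x z
  have hDneg : orient u v x < 0 := by linarith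
  set D := orient u v x with hDdef
  have hz : z = (orient v x z / D) • u + (orient x u z / D) • v + (orient u v z / D) • x := by
    have hne := hDneg.ne
    apply plane_ext <;>
      simp only [PiLp.add_apply, PiLp.smul_apply, smul_eq_mul] <;> field_simp <;>
      simp only [hDdef, orient] <;> ring
  have key := hQ.sum_mem (t := Finset.univ)
    (w := ![orient v x z / D, orient x u z / D, orient u v z / D]) (z := ![u, v, x])
    (by
      intro i _
      fin_cases i
      · exact (div_pos_of_neg_of_neg h2 hDneg).le
      · exact (div_pos_of_neg_of_neg h3 hDneg).le
      · exact (div_pos_of_neg_of_neg h1 hDneg).le)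
    (by
      simp only [Fin.sum_univ_three, Matrix.cons_val_zero, Matrix.cons_val_one, Matrix.cons_val]
      have hne := hDneg.ne
      field_simp
      linarith)
    (by intro i _; fin_cases i <;> assumption)
  simp only [Fin.sum_univ_three, Matrix.cons_val_zero, Matrix.cons_val_one, Matrix.cons_val] at key
  rw [hz]
  exact key

lemma interior_nonempty_of_orient_neg {Q : Set Plane} (hQ : Convex ℝ Q) {u v x : Plane}
    (hu : u ∈ Q) (hv : v ∈ Q) (hx : x ∈ Q) (h : orient u v x < 0) : (interior Q).Nonempty := by
  refine ⟨(1 / 3 : ℝ) • (u + v + x), mem_interior_of_orient_neg hQ hu hv hx ?_ ?_ ?_⟩ <;>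
  · simp only [orient, PiLp.add_apply, PiLp.smul_apply, smul_eq_mul] at h ⊢
    nlinarith

lemma interior_nonempty_of_orient_ne_zero {Q : Set Plane} (hQ : Convex ℝ Q) {u v x : Plane}
    (hu : u ∈ Q) (hv : v ∈ Q) (hx : x ∈ Q) (h : orient u v x ≠ 0) : (interior Q).Nonempty := by
  rcases h.lt_or_gt with h | h
  · exact interior_nonempty_of_orient_neg hQ hu hv hx h
  · exact interior_nonempty_of_orient_neg hQ hv hu hx (by rw [orient_swap]; linarith)

lemma IsConvexPolygonalRegion.inter {Q : Set Plane} (hQ : IsConvexPolygonalRegion Q) {u v : Plane}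
    (huv : u ≠ v) (hne : (interior (Q ∩ rightHalfPlane u v)).Nonempty) :
    IsConvexPolygonalRegion (Q ∩ rightHalfPlane u v) := by
  classical
  obtain ⟨⟨H, hH, rfl⟩, -⟩ := hQ
  refine ⟨⟨insert (u, v) H, ?_, ?_⟩, hne⟩
  · intro h hh
    rcases Finset.mem_insert.1 hh with rfl | hh
    · exact huv
    · exact hH h hh
  · rw [Finset.set_biInter_insert, Set.inter_comm]

/-- Cutting a region by a half-plane gives a region as soon as the part that is left contains a
nondegenerate triangle. -/
lemma IsConvexPolygonalRegion.inter_of_triangle {Q : Set Plane} (hQ : IsConvexPolygonalRegion Q)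
    {u v x y z : Plane} (huv : u ≠ v) (hx : x ∈ Q ∩ rightHalfPlane u v)
    (hy : y ∈ Q ∩ rightHalfPlane u v) (hz : z ∈ Q ∩ rightHalfPlane u v) (h : orient x y z ≠ 0) :
    IsConvexPolygonalRegion (Q ∩ rightHalfPlane u v) :=
  hQ.inter huv <| interior_nonempty_of_orient_ne_zero
    (hQ.convex.inter (convex_rightHalfPlane u v)) hx hy hz h

/-- A point on the line bounding a half-plane is not interior to any subset of the half-plane. -/
lemma notMem_interior_of_subset_rightHalfPlane {S : Set Plane} {u v x : Plane} (huv : u ≠ v)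
    (hS : S ⊆ rightHalfPlane u v) (hx : orient u v x = 0) : x ∉ interior S := by
  intro hxS
  have hpos := sq_add_sq_pos_of_ne huv
  set d : Plane := !₂[-(v 1 - u 1), v 0 - u 0] with hd
  have hcont : Continuous fun t : ℝ => x + t • d := by fun_prop
  have hmem : ∀ᶠ t : ℝ in 𝓝 0, x + t • d ∈ S := by
    have : S ∈ 𝓝 (x + (0 : ℝ) • d) := by simpa using mem_interior_iff_mem_nhds.1 hxS
    exact hcont.continuousAt.eventually_mem this
  have hright : ∀ᶠ t : ℝ in 𝓝[>] 0, x + t • d ∈ S := nhdsWithin_le_nhds hmem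
  obtain ⟨t, htS, ht⟩ := (hright.and self_mem_nhdsWithin).exists
  have h1 := hS htS
  rw [mem_rightHalfPlane] at h1
  have h2 : orient u v (x + t • d) =
      orient u v x + t * ((v 0 - u 0) ^ 2 + (v 1 - u 1) ^ 2) := by
    simp only [orient, hd, PiLp.add_apply, PiLp.smul_apply, smul_eq_mul]
    simp
    ring
  rw [h2, hx] at h1
  have : 0 < t * ((v 0 - u 0) ^ 2 + (v 1 - u 1) ^ 2) := mul_pos ht hpos
  linarith

lemma interior_inter_opposite_halfPlanes {u v : Plane} (huv : u ≠ v) :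
    interior (rightHalfPlane u v ∩ rightHalfPlane v u) = ∅ := by
  rw [Set.eq_empty_iff_forall_notMem]
  intro x hx
  have h := interior_subset hx
  have h1 : orient u v x ≤ 0 := h.1
  have h2 : orient v u x ≤ 0 := h.2
  rw [orient_swap] at h2
  exact notMem_interior_of_subset_rightHalfPlane huv Set.inter_subset_left (by linarith) hx

/-! ### Moving cuts and weighted assignments -/

section Assignments

variable {α ι T : Type*} [Fintype α]

/-- The total weight of the elements that the assignment `κ` sends to the part `k`. -/
def partWeight [DecidableEq ι] (w : α → ℤ) (κ : α → ι) (k : ι) : ℤ :=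
  ∑ x, if κ x = k then w x else 0

/-- The assignment `κ` sends every element `x` to a part that contains it when the cut is at the
position `t`; here `C k x` is the set of positions for which the closed part `k` contains `x`, so
that an element on the border of several parts may be sent to any of them. -/
def Admissible (C : ι → α → Set T) (t : T) (κ : α → ι) : Prop :=
  ∀ x, t ∈ C (κ x) x

lemma isClosed_exists_admissible [Finite ι] [TopologicalSpace T] {C : ι → α → Set T}
    (hC : ∀ k x, IsClosed (C k x)) (S : (α → ι) → Prop) :
    IsClosed {t | ∃ κ, Admissible C t κ ∧ S κ} := by
  have h : {t | ∃ κ, Admissible C t κ ∧ S κ} =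
      ⋃ κ ∈ {κ : α → ι | S κ}, ⋂ x, C (κ x) x := by
    ext t
    simp only [Admissible, Set.mem_ofPred_eq, Set.mem_iUnion, Set.mem_iInter, exists_prop]
    exact exists_congr fun κ => and_comm
  rw [h]
  exact (Set.toFinite _).isClosed_biUnion fun κ _ => isClosed_iInter fun x => hC _ _

/-- If every position admits an assignment, and the quantity `N` passes from one side of `q` to the
other while the position moves through an interval, then at some position admissible assignments
exist on both sides of `q`. -/
lemma exists_admissible_le_ge [Finite ι] {C : ι → α → Set ℝ} (hC : ∀ k x, IsClosed (C k x))
    {t₀ t₁ : ℝ} (ht : t₀ ≤ t₁) (hcov : ∀ t ∈ Set.Icc t₀ t₁, ∀ x, ∃ k, t ∈ C k x)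
    (N : (α → ι) → ℤ) (q : ℤ) (h₀ : ∃ κ, Admissible C t₀ κ ∧ N κ ≤ q)
    (h₁ : ∃ κ, Admissible C t₁ κ ∧ q ≤ N κ) :
    ∃ t ∈ Set.Icc t₀ t₁, (∃ κ, Admissible C t κ ∧ N κ ≤ q) ∧
      ∃ κ, Admissible C t κ ∧ q ≤ N κ := by
  have h := isPreconnected_closed_iff.1 (isPreconnected_Icc (a := t₀) (b := t₁)) _ _
    (isClosed_exists_admissible hC fun κ => N κ ≤ q)
    (isClosed_exists_admissible hC fun κ => q ≤ N κ) ?_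
    ⟨t₀, Set.left_mem_Icc.2 ht, h₀⟩ ⟨t₁, Set.right_mem_Icc.2 ht, h₁⟩
  · exact h
  · intro t htm
    choose κ hκ using hcov t htm
    rcases le_total (N κ) q with h | h
    · exact Or.inl ⟨κ, hκ, h⟩
    · exact Or.inr ⟨κ, hκ, h⟩

lemma abs_sum_sub_sum_le_one {f g : α → ℤ} (hfg : ∀ x, |f x - g x| ≤ 1)
    (h : ∀ x y, f x ≠ g x → f y ≠ g y → x = y) : |∑ x, f x - ∑ x, g x| ≤ 1 := by
  rw [← Finset.sum_sub_distrib]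
  by_cases hex : ∃ x, f x ≠ g x
  · obtain ⟨x, hx⟩ := hex
    rw [Finset.sum_eq_single x (fun y _ hy => ?_) (by simp)]
    · exact hfg x
    · by_contra hne
      exact hy (h y x (sub_ne_zero.1 hne) hx)
  · push Not at hex
    simp [hex]

lemma abs_partWeight_sub_le_one [DecidableEq ι] {w : α → ℤ} (hw : ∀ x, |w x| ≤ 1)
    {κ κ' : α → ι} {k : ι}
    (h : ∀ x y, ((κ x = k ∧ κ' x ≠ k) ∨ (κ x ≠ k ∧ κ' x = k)) →
      ((κ y = k ∧ κ' y ≠ k) ∨ (κ y ≠ k ∧ κ' y = k)) → x = y) :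
    |partWeight w κ k - partWeight w κ' k| ≤ 1 := by
  refine abs_sum_sub_sum_le_one (fun x => ?_) fun x y hx hy => h x y ?_ ?_
  · have := hw x
    split_ifs <;> simp [this]
  · by_cases h1 : κ x = k <;> by_cases h2 : κ' x = k <;> simp_all
  · by_cases h1 : κ y = k <;> by_cases h2 : κ' y = k <;> simp_all

/-- Two assignments to three parts whose weights on the part `k` enclose `q` strictly, and for which
at most one element is moved between `k` and either of the other parts, can be mixed to an
assignment of weight `q` on `k`. The mixture moves only an element between `k` and `j`, so that the third part
keeps its weight. -/
lemma exists_partWeight_eq {w : α → ℤ} (hw : ∀ x, |w x| ≤ 1) {κ₁ κ₂ : α → Fin 3} {k j l : Fin 3}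
    (hkj : k ≠ j) (hkl : k ≠ l) (hjl : j ≠ l) {q : ℤ} (h₁ : partWeight w κ₁ k < q)
    (h₂ : q < partWeight w κ₂ k)
    (hj : ∀ x y, ((κ₁ x = k ∧ κ₂ x = j) ∨ (κ₁ x = j ∧ κ₂ x = k)) →
      ((κ₁ y = k ∧ κ₂ y = j) ∨ (κ₁ y = j ∧ κ₂ y = k)) → x = y)
    (hl : ∀ x y, ((κ₁ x = k ∧ κ₂ x = l) ∨ (κ₁ x = l ∧ κ₂ x = k)) →
      ((κ₁ y = k ∧ κ₂ y = l) ∨ (κ₁ y = l ∧ κ₂ y = k)) → x = y) :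
    ∃ κ : α → Fin 3, (∀ x, κ x = κ₁ x ∨ κ x = κ₂ x) ∧ partWeight w κ k = q ∧
      partWeight w κ l = partWeight w κ₁ l := by
  classical
  have htri : ∀ i : Fin 3, i ≠ k → i ≠ j → i = l := by omega
  set κ : α → Fin 3 := fun x =>
    if (κ₁ x = k ∧ κ₂ x = j) ∨ (κ₁ x = j ∧ κ₂ x = k) then κ₂ x else κ₁ x with hκ
  have hκval : ∀ x, κ x = if (κ₁ x = k ∧ κ₂ x = j) ∨ (κ₁ x = j ∧ κ₂ x = k) then κ₂ x else κ₁ x :=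
    fun _ => rfl
  refine ⟨κ, fun x => ?_, ?_, ?_⟩
  · rw [hκval]; split_ifs <;> simp
  · have e1 : |partWeight w κ k - partWeight w κ₁ k| ≤ 1 := by
      refine abs_partWeight_sub_le_one hw fun x y hx hy => hj x y ?_ ?_
      · by_contra hne; rw [hκval, if_neg hne] at hx; tauto
      · by_contra hne; rw [hκval, if_neg hne] at hy; tauto
    have e2 : |partWeight w κ k - partWeight w κ₂ k| ≤ 1 := by
      have aux : ∀ x, ((κ x = k ∧ κ₂ x ≠ k) ∨ (κ x ≠ k ∧ κ₂ x = k)) →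
          ((κ₁ x = k ∧ κ₂ x = l) ∨ (κ₁ x = l ∧ κ₂ x = k)) := by
        intro x hx
        rw [hκval] at hx
        split_ifs at hx with hc
        · tauto
        · rcases hx with ⟨h1, h2⟩ | ⟨h1, h2⟩
          · exact Or.inl ⟨h1, htri _ h2 fun h3 => hc (Or.inl ⟨h1, h3⟩)⟩
          · exact Or.inr ⟨htri _ h1 fun h3 => hc (Or.inr ⟨h3, h2⟩), h2⟩
      exact abs_partWeight_sub_le_one hw fun x y hx hy => hl x y (aux x hx) (aux y hy)
    rw [abs_le] at e1 e2
    omega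
  · refine Finset.sum_congr rfl fun x _ => ?_
    rw [hκval]
    split_ifs with hc h1 h2 h2
    · rfl
    · rcases hc with ⟨_, h⟩ | ⟨_, h⟩ <;> simp_all
    · rcases hc with ⟨h, _⟩ | ⟨h, _⟩ <;> simp_all
    · rfl
    · rfl
    · rfl

lemma sum_partWeight (w : α → ℤ) (κ : α → Fin 3) :
    partWeight w κ 0 + partWeight w κ 1 + partWeight w κ 2 = ∑ x, w x := by
  simp only [partWeight, ← Finset.sum_add_distrib]
  refine Finset.sum_congr rfl fun x _ => ?_
  generalize κ x = i
  fin_cases i <;> simp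

end Assignments

/-- A line rotates from the position where its closed positive side `g₀ ≥ 0` has no element of
weight `1` to a position where its positive side `g₁ > 0` has weight more than `1`. If it never
meets two elements at a time, then in between it cuts off weight exactly `1`. -/
lemma exists_rotating_cut {α : Type*} [Fintype α] {w : α → ℤ} (hw : ∀ x, w x = 1 ∨ w x = -1)
    {g₀ g₁ : α → ℝ} (h₀ : ∀ x, w x = 1 → g₀ x < 0) (hg₁ : ∀ x, g₁ x ≠ 0)
    (h₁ : 1 < ∑ x, if 0 < g₁ x then w x else 0)
    (hline : ∀ x y, x ≠ y → g₀ x * g₁ y ≠ g₁ x * g₀ y) :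
    ∃ t : ℝ, 0 < t ∧ t < 1 ∧ ∃ κ : α → Bool,
      (∀ x, κ x = true → 0 ≤ (1 - t) * g₀ x + t * g₁ x) ∧
      (∀ x, κ x = false → (1 - t) * g₀ x + t * g₁ x ≤ 0) ∧ partWeight w κ true = 1 := by
  classical
  let C : Bool → α → Set ℝ := fun k x =>
    if k then {t | 0 ≤ (1 - t) * g₀ x + t * g₁ x} else {t | (1 - t) * g₀ x + t * g₁ x ≤ 0}
  have hC : ∀ k x, IsClosed (C k x) := by
    intro k x
    cases k
    · exact isClosed_le (by fun_prop) continuous_const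
    · exact isClosed_le continuous_const (by fun_prop)
  have hcov : ∀ t ∈ Set.Icc (0 : ℝ) 1, ∀ x, ∃ k, t ∈ C k x := by
    intro t _ x
    rcases le_total 0 ((1 - t) * g₀ x + t * g₁ x) with h | h
    · exact ⟨true, h⟩
    · exact ⟨false, h⟩
  have hT : ∀ {t κ x}, Admissible C t κ → κ x = true → 0 ≤ (1 - t) * g₀ x + t * g₁ x := by
    intro t κ x h hx
    have := h x
    rw [hx] at this
    exact this
  have hF : ∀ {t κ x}, Admissible C t κ → κ x = false → (1 - t) * g₀ x + t * g₁ x ≤ 0 := by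
    intro t κ x h hx
    have := h x
    rw [hx] at this
    exact this
  have hN0 : ∀ κ, Admissible C 0 κ → partWeight w κ true ≤ 0 := by
    intro κ hκ
    refine Finset.sum_nonpos fun x _ => ?_
    split_ifs with hx
    · have h := hT hκ hx
      rcases hw x with h1 | h1
      · have := h₀ x h1
        simp at h
        linarith
      · omega
    · exact le_rfl
  have hN1 : ∀ κ, Admissible C 1 κ → 1 < partWeight w κ true := by
    intro κ hκ
    convert h₁ using 1
    refine Finset.sum_congr rfl fun x _ => ?_
    have : κ x = true ↔ 0 < g₁ x := by
      constructor
      · intro hx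
        have h := hT hκ hx
        simp at h
        exact lt_of_le_of_ne h (hg₁ x).symm
      · intro hx
        by_contra hne
        have h := hF hκ (by simpa using hne)
        simp at h
        linarith
    simp only [this]
  choose κ₀ hκ₀ using hcov 0 (by simp)
  choose κ₁ hκ₁ using hcov 1 (by simp)
  obtain ⟨t, ht, ⟨κ, hκ, hκ1⟩, ⟨κ', hκ', hκ1'⟩⟩ := exists_admissible_le_ge hC zero_le_one hcov
    (fun κ => partWeight w κ true) 1 ⟨κ₀, hκ₀, (hN0 κ₀ hκ₀).trans zero_le_one⟩
    ⟨κ₁, hκ₁, (hN1 κ₁ hκ₁).le⟩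
  have hdiff : |partWeight w κ true - partWeight w κ' true| ≤ 1 := by
    have aux : ∀ x, ((κ x = true ∧ κ' x ≠ true) ∨ (κ x ≠ true ∧ κ' x = true)) →
        (1 - t) * g₀ x + t * g₁ x = 0 := by
      rintro x (⟨h1, h2⟩ | ⟨h1, h2⟩)
      · exact le_antisymm (hF hκ' (by simpa using h2)) (hT hκ h1)
      · exact le_antisymm (hF hκ (by simpa using h1)) (hT hκ' h2)
    refine abs_partWeight_sub_le_one (fun x => by rcases hw x with h | h <;> simp [h])
      fun x y hx hy => ?_
    by_contra hne
    have ex := aux x hx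
    have ey := aux y hy
    apply hline x y hne
    rcases eq_or_ne t 0 with rfl | h0
    · simp at ex ey
      rw [ex, ey]; ring
    · apply mul_left_cancel₀ h0
      linear_combination g₀ x * ey - g₀ y * ex
  have hex : ∃ κ, Admissible C t κ ∧ partWeight w κ true = 1 := by
    rw [abs_le] at hdiff
    rcases hκ1.lt_or_eq with h | h
    · exact ⟨κ', hκ', by
        have h2 : 1 ≤ partWeight w κ' true := hκ1'
        have h3 : partWeight w κ true < 1 := h
        omega⟩
    · exact ⟨κ, hκ, h⟩
  obtain ⟨κ, hκ, hone⟩ := hex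
  refine ⟨t, lt_of_le_of_ne ht.1 ?_, lt_of_le_of_ne ht.2 ?_, κ, fun x => hT hκ, fun x => hF hκ,
    hone⟩
  · rintro rfl
    have := hN0 κ hκ
    omega
  · rintro rfl
    have := hN1 κ hκ
    omega

/-! ### Three-way cuts of a triangle -/

/-- Let `a, p, s` be the barycentric coordinates, up to a common positive factor, of a point `x` in
a triangle `A P S`, and let `c = (1 - r) P + r ((1 - θ) A + θ S)`. The rays from `c` to the vertices
split the plane into three cones: part `0` between `A` and `P`, part `1` between `P` and `S`, and
part `2` between `S` and `A`. The set `cone a p s k` consists of the pairs `(θ, r)` for which `x` is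
in part `k`. The ray through `P` enters as the line joining `P` to `(1 - θ) A + θ S`, which makes
sense for `c = P` too. -/
def cone (a p s : ℝ) : Fin 3 → Set (ℝ × ℝ) :=
  ![{y | 0 ≤ -(1 - y.2) * s + y.2 * y.1 * p ∧ 0 ≤ -(1 - y.1) * s + y.1 * a},
    {y | -(1 - y.1) * s + y.1 * a ≤ 0 ∧ 0 ≤ -(1 - y.2) * a + y.2 * (1 - y.1) * p},
    {y | -(1 - y.2) * a + y.2 * (1 - y.1) * p ≤ 0 ∧ -(1 - y.2) * s + y.2 * y.1 * p ≤ 0}]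

section Cone

variable {a p s θ r r' : ℝ}

lemma mem_cone_zero : (θ, r) ∈ cone a p s 0 ↔
    0 ≤ -(1 - r) * s + r * θ * p ∧ 0 ≤ -(1 - θ) * s + θ * a := Iff.rfl

lemma mem_cone_one : (θ, r) ∈ cone a p s 1 ↔
    -(1 - θ) * s + θ * a ≤ 0 ∧ 0 ≤ -(1 - r) * a + r * (1 - θ) * p := Iff.rfl

lemma mem_cone_two : (θ, r) ∈ cone a p s 2 ↔
    -(1 - r) * a + r * (1 - θ) * p ≤ 0 ∧ -(1 - r) * s + r * θ * p ≤ 0 := Iff.rfl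

lemma isClosed_cone (a p s : ℝ) (k : Fin 3) : IsClosed (cone a p s k) := by
  have hz : Continuous fun y : ℝ × ℝ => -(1 - y.2) * s + y.2 * y.1 * p := by fun_prop
  have hu : Continuous fun y : ℝ × ℝ => -(1 - y.1) * s + y.1 * a := by fun_prop
  have hv : Continuous fun y : ℝ × ℝ => -(1 - y.2) * a + y.2 * (1 - y.1) * p := by fun_prop
  fin_cases k
  · exact (isClosed_le continuous_const hz).inter (isClosed_le continuous_const hu)
  · exact (isClosed_le hu continuous_const).inter (isClosed_le continuous_const hv)
  · exact (isClosed_le hv continuous_const).inter (isClosed_le hz continuous_const)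

lemma exists_mem_cone (hθ : 0 ≤ θ) (hθ' : θ ≤ 1) (hr' : r ≤ 1) :
    ∃ k, (θ, r) ∈ cone a p s k := by
  by_contra hcon
  push Not at hcon
  have h0 := hcon 0
  have h1 := hcon 1
  have h2 := hcon 2
  rw [mem_cone_zero] at h0
  rw [mem_cone_one] at h1
  rw [mem_cone_two] at h2
  -- the three linear forms satisfy one linear relation, with nonnegative coefficients
  have hrel : (1 - r) * (-(1 - θ) * s + θ * a) + θ * (-(1 - r) * a + r * (1 - θ) * p) =
      (1 - θ) * (-(1 - r) * s + r * θ * p) := by ring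
  generalize -(1 - r) * s + r * θ * p = z at *
  generalize -(1 - θ) * s + θ * a = u at *
  generalize -(1 - r) * a + r * (1 - θ) * p = v at *
  rcases lt_trichotomy u 0 with hu | hu | hu
  · have hv : v < 0 := by by_contra h; exact h1 ⟨hu.le, not_lt.1 h⟩
    have hz : 0 < z := by by_contra h; exact h2 ⟨hv.le, not_lt.1 h⟩
    rcases hθ'.lt_or_eq with h | rfl
    · nlinarith [mul_pos (sub_pos.2 h) hz, mul_nonneg hθ (neg_pos.2 hv).le,
        mul_nonneg (sub_nonneg.2 hr') (neg_pos.2 hu).le]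
    · nlinarith [mul_nonneg (sub_nonneg.2 hr') (neg_pos.2 hu).le]
  · have hz : z < 0 := by by_contra h; exact h0 ⟨not_lt.1 h, hu.ge⟩
    have hv : v < 0 := by by_contra h; exact h1 ⟨hu.le, not_lt.1 h⟩
    exact h2 ⟨hv.le, hz.le⟩
  · have hz : z < 0 := by by_contra h; exact h0 ⟨not_lt.1 h, hu.le⟩
    have hv : 0 < v := by by_contra h; exact h2 ⟨not_lt.1 h, hz.le⟩
    rcases hθ'.lt_or_eq with h | rfl
    · nlinarith [mul_pos (sub_pos.2 h) (neg_pos.2 hz), mul_nonneg hθ hv.le,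
        mul_nonneg (sub_nonneg.2 hr') hu.le]
    · nlinarith [mul_nonneg (sub_nonneg.2 hr') hu.le]

/-- Moving `c` away from `P` on a ray from `P` does not bring a point on the inner side of the line
`P S` into the part opposite to `P`. -/
lemma eq_two_of_pos (hθ : 0 ≤ θ) (hθ' : θ < 1) (hr : 0 < r) (hrr : r < r') (hr' : r' < 1)
    (ha : 0 < a) (hp : p ≠ 0) (hs : s ≠ 0) (hps : ¬(p < 0 ∧ s < 0))
    (h : (θ, r') ∈ cone a p s 2) {k : Fin 3} (hk : (θ, r) ∈ cone a p s k) : k = 2 := by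
  rw [mem_cone_two] at h
  obtain ⟨h1, h2⟩ := h
  have hv : -(1 - r) * a + r * (1 - θ) * p < 0 := by
    rcases hp.lt_or_gt with hp | hp
    · nlinarith [mul_pos (sub_pos.2 (hrr.trans hr')) ha,
        mul_pos (mul_pos hr (sub_pos.2 hθ')) (neg_pos.2 hp)]
    · nlinarith [mul_pos (mul_pos (sub_pos.2 hrr) (sub_pos.2 hθ')) hp,
        mul_pos (sub_pos.2 hrr) ha]
  have hz : -(1 - r) * s + r * θ * p < 0 := by
    rcases hp.lt_or_gt with hp | hp
    · have hs : 0 < s := lt_of_le_of_ne (by by_contra hc; exact hps ⟨hp, not_le.1 hc⟩) hs.symm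
      nlinarith [mul_pos (sub_pos.2 (hrr.trans hr')) hs,
        mul_nonneg (mul_nonneg hr.le hθ) (neg_pos.2 hp).le]
    · have hθp : 0 ≤ r' * θ * p := by have := hr.trans hrr; positivity
      have hs : 0 < s := by
        refine lt_of_le_of_ne ?_ hs.symm
        by_contra hc
        nlinarith [mul_pos (sub_pos.2 hr') (neg_pos.2 (not_le.1 hc))]
      nlinarith [mul_nonneg (mul_nonneg (sub_pos.2 hrr).le hθ) hp.le,
        mul_pos (sub_pos.2 hrr) hs]
  fin_cases k
  · exact absurd hk.1 (not_le.2 hz)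
  · exact absurd hk.2 (not_le.2 hv)
  · rfl

/-- Moving `c` away from `P` on a ray from `P` keeps a point outside the triangle in the part
opposite to `P` if it was there. -/
lemma eq_two_of_outside (hθ : 0 ≤ θ) (hθ' : θ < 1) (hr : 0 < r) (hrr : r < r') (hr' : r' < 1)
    (ha : a ≠ 0) (hp : p ≠ 0) (hs : s ≠ 0) (hps : ¬(p < 0 ∧ s < 0))
    (hout : ¬(0 < a ∧ 0 < p ∧ 0 < s))
    (h : (θ, r) ∈ cone a p s 2) {k : Fin 3} (hk : (θ, r') ∈ cone a p s k) : k = 2 := by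
  rw [mem_cone_two] at h
  obtain ⟨h1, h2⟩ := h
  have hr1 : 0 < 1 - r := by linarith
  have hp : p < 0 := by
    by_contra hc
    have hp : 0 < p := lt_of_le_of_ne (not_lt.1 hc) hp.symm
    refine hout ⟨lt_of_le_of_ne ?_ ha.symm, hp, lt_of_le_of_ne ?_ hs.symm⟩
    · by_contra hc
      nlinarith [mul_pos hr1 (neg_pos.2 (not_le.1 hc)), mul_pos (mul_pos hr (sub_pos.2 hθ')) hp]
    · by_contra hc
      nlinarith [mul_pos hr1 (neg_pos.2 (not_le.1 hc)), mul_nonneg (mul_nonneg hr.le hθ) hp.le]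
  have hs : 0 < s := lt_of_le_of_ne (by by_contra hc; exact hps ⟨hp, not_le.1 hc⟩) hs.symm
  have hz : -(1 - r') * s + r' * θ * p < 0 := by
    nlinarith [mul_pos (sub_pos.2 hr') hs,
      mul_nonneg (mul_nonneg (hr.trans hrr).le hθ) (neg_pos.2 hp).le]
  have hv : -(1 - r') * a + r' * (1 - θ) * p < 0 := by
    have hq : (1 - θ) * p < 0 := mul_neg_of_pos_of_neg (sub_pos.2 hθ') hp
    rcases ha.lt_or_gt with ha | ha
    · nlinarith [mul_pos (sub_pos.2 hrr) (neg_pos.2 hq), mul_pos (sub_pos.2 hrr) (neg_pos.2 ha)]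
    · nlinarith [mul_pos (sub_pos.2 hr') ha, mul_pos (hr.trans hrr) (neg_pos.2 hq)]
  fin_cases k
  · exact absurd hk.1 (not_le.2 hz)
  · exact absurd hk.2 (not_le.2 hv)
  · rfl

/-- For `c` on the side `A S`, part `2` is what lies beyond the line `A S`. -/
lemma eq_two_iff_of_right_end (hθ : 0 ≤ θ) (hθ' : θ < 1) (hp : p ≠ 0) (hs : s ≠ 0)
    (hps : ¬(p < 0 ∧ s < 0)) {k : Fin 3} (hk : (θ, 1) ∈ cone a p s k) : k = 2 ↔ p < 0 := by
  have h1 : 0 < 1 - θ := by linarith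
  fin_cases k
  · obtain ⟨hz, hu⟩ := mem_cone_zero.1 hk
    simp only [sub_self, neg_zero, zero_mul, zero_add, one_mul] at hz hu
    refine iff_of_false (by decide) fun hp => ?_
    obtain rfl : θ = 0 := by
      by_contra hne
      have : 0 < θ := lt_of_le_of_ne hθ (Ne.symm hne)
      nlinarith [mul_pos this (neg_pos.2 hp)]
    refine hps ⟨hp, lt_of_le_of_ne ?_ hs⟩
    linarith
  · obtain ⟨-, hv⟩ := mem_cone_one.1 hk
    simp only [sub_self, neg_zero, zero_mul, zero_add, one_mul] at hv
    refine iff_of_false (by decide) fun hp => ?_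
    nlinarith
  · obtain ⟨hv, -⟩ := mem_cone_two.1 hk
    simp only [sub_self, neg_zero, zero_mul, zero_add, one_mul] at hv
    refine iff_of_true rfl (lt_of_le_of_ne ?_ hp)
    nlinarith

/-- For `c = P`, part `2` is the angle of the triangle at `P`. -/
lemma eq_two_iff_of_left_end (ha : a ≠ 0) (hs : s ≠ 0) {k : Fin 3}
    (hk : (θ, 0) ∈ cone a p s k) : k = 2 ↔ 0 < a ∧ 0 < s := by
  fin_cases k
  · obtain ⟨hz, -⟩ := mem_cone_zero.1 hk
    refine iff_of_false (by decide) ?_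
    rintro ⟨-, hs⟩
    linarith
  · obtain ⟨-, hv⟩ := mem_cone_one.1 hk
    refine iff_of_false (by decide) ?_
    rintro ⟨ha, -⟩
    linarith
  · obtain ⟨hv, hz⟩ := mem_cone_two.1 hk
    refine iff_of_true rfl ⟨lt_of_le_of_ne ?_ ha.symm, lt_of_le_of_ne ?_ hs.symm⟩ <;> linarith

/-- For `c` on the side `A P`, part `0` is what lies beyond the line `A P`. -/
lemma eq_zero_iff_of_bottom (hr' : r < 1) (hs : s ≠ 0) {k : Fin 3}
    (hk : ((0 : ℝ), r) ∈ cone a p s k) : k = 0 ↔ s < 0 := by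
  have h1 : 0 < 1 - r := by linarith
  fin_cases k
  · obtain ⟨-, hu⟩ := mem_cone_zero.1 hk
    refine iff_of_true rfl (lt_of_le_of_ne ?_ hs)
    linarith
  · obtain ⟨hu, -⟩ := mem_cone_one.1 hk
    refine iff_of_false (by decide) fun hs => ?_
    linarith
  · obtain ⟨-, hz⟩ := mem_cone_two.1 hk
    refine iff_of_false (by decide) fun hs => ?_
    nlinarith

end Cone

/-! ### The intermediate value argument for three-way cuts -/

/-- The data of a three-way cut: every element `x` of a finite set has a weight `±1` and barycentric
coordinates `ξA x, ξP x, ξS x`, up to a common positive factor, in a triangle `A P S`. Elements of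
weight `1` lie on the inner side of the line `P S`, those of weight `-1` outside the triangle, no
element lies in the sector opposite to the triangle at `A`, and no vertex is collinear with two
elements or with another vertex and an element. The required weights of the parts `0`, `1` and `2`
of a cut are `tL`, `1` and `tR`, and the elements beyond the lines `A P` and `A S` weigh less
than `tL` and `tR` respectively. -/
structure ThreeWayData {α : Type*} [Fintype α] (w : α → ℤ) (ξA ξP ξS : α → ℝ) (tL tR : ℤ) :
    Prop where
  weight : ∀ x, w x = 1 ∨ w x = -1
  neA : ∀ x, ξA x ≠ 0
  neP : ∀ x, ξP x ≠ 0
  neS : ∀ x, ξS x ≠ 0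
  blue : ∀ x, w x = 1 → 0 < ξA x
  red : ∀ x, w x = -1 → ¬(0 < ξA x ∧ 0 < ξP x ∧ 0 < ξS x)
  sector : ∀ x, ¬(ξP x < 0 ∧ ξS x < 0)
  lineA : ∀ x y, x ≠ y → ξP x * ξS y ≠ ξS x * ξP y
  lineP : ∀ x y, x ≠ y → ξA x * ξS y ≠ ξS x * ξA y
  lineS : ∀ x y, x ≠ y → ξA x * ξP y ≠ ξP x * ξA y
  total : ∑ x, w x = tL + 1 + tR
  left : (∑ x, if ξS x < 0 then w x else 0) < tL
  right : (∑ x, if ξP x < 0 then w x else 0) < tR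

namespace ThreeWayData

variable {α : Type*} [Fintype α] {w : α → ℤ} {ξA ξP ξS : α → ℝ} {tL tR : ℤ}

/-- The assignments that are admissible for the cut with parameters `y = (θ, r)`. -/
abbrev Adm {β : Type*} (ξA ξP ξS : β → ℝ) (y : ℝ × ℝ) (κ : β → Fin 3) : Prop :=
  Admissible (fun k x => cone (ξA x) (ξP x) (ξS x) k) y κ

lemma abs_weight (h : ThreeWayData w ξA ξP ξS tL tR) (x : α) : |w x| ≤ 1 := by
  rcases h.weight x with h | h <;> simp [h]

lemma exists_adm {β : Type*} {ξA ξP ξS : β → ℝ} {θ r : ℝ} (hθ : 0 ≤ θ) (hθ' : θ ≤ 1)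
    (hr' : r ≤ 1) : ∃ κ, Adm ξA ξP ξS (θ, r) κ := by
  choose κ hκ using fun x => exists_mem_cone (a := ξA x) (p := ξP x) (s := ξS x) hθ hθ' hr'
  exact ⟨κ, hκ⟩

lemma partWeight_two_lt_of_right_end (h : ThreeWayData w ξA ξP ξS tL tR) {θ : ℝ} (hθ : 0 ≤ θ)
    (hθ' : θ < 1) {κ : α → Fin 3} (hκ : Adm ξA ξP ξS (θ, 1) κ) : partWeight w κ 2 < tR := by
  convert h.right using 1
  refine Finset.sum_congr rfl fun x _ => ?_
  simp only [eq_two_iff_of_right_end hθ hθ' (h.neP x) (h.neS x) (h.sector x) (hκ x)]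

lemma lt_partWeight_two_of_left_end (h : ThreeWayData w ξA ξP ξS tL tR) {θ : ℝ}
    {κ : α → Fin 3} (hκ : Adm ξA ξP ξS (θ, 0) κ) : tR < partWeight w κ 2 := by
  have hle : ∑ x, w x ≤ partWeight w κ 2 + ∑ x, if ξS x < 0 then w x else 0 := by
    simp only [partWeight, ← Finset.sum_add_distrib]
    refine Finset.sum_le_sum fun x _ => ?_
    have h2 := eq_two_iff_of_left_end (h.neA x) (h.neS x) (hκ x)
    by_cases hs : ξS x < 0
    · have hk : κ x ≠ 2 := fun hk => by linarith [(h2.1 hk).2]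
      simp [hs, hk]
    · have hs' : 0 < ξS x := lt_of_le_of_ne (not_lt.1 hs) (h.neS x).symm
      by_cases ha : 0 < ξA x
      · simp [h2.2 ⟨ha, hs'⟩, hs]
      · have hk : κ x ≠ 2 := fun hk => ha (h2.1 hk).1
        rcases h.weight x with hw | hw
        · exact absurd (h.blue x hw) ha
        · simp [hs, hk, hw]
  have := h.total
  have := h.left
  omega

lemma partWeight_zero_lt_of_bottom (h : ThreeWayData w ξA ξP ξS tL tR) {r : ℝ} (hr' : r < 1)
    {κ : α → Fin 3} (hκ : Adm ξA ξP ξS (0, r) κ) : partWeight w κ 0 < tL := by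
  convert h.left using 1
  refine Finset.sum_congr rfl fun x _ => ?_
  simp only [eq_zero_iff_of_bottom hr' (h.neS x) (hκ x)]

/-- The weight of part `2` decreases when `c` moves away from `P` on a ray from `P`, whatever
assignments are chosen: elements of weight `1` do not enter the part and those of weight `-1` do not
leave it. -/
lemma partWeight_two_le (h : ThreeWayData w ξA ξP ξS tL tR) {θ r r' : ℝ} (hθ : 0 ≤ θ) (hθ' : θ < 1)
    (hr : 0 < r) (hrr : r < r') (hr' : r' < 1) {κ κ' : α → Fin 3} (hκ : Adm ξA ξP ξS (θ, r) κ)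
    (hκ' : Adm ξA ξP ξS (θ, r') κ') : partWeight w κ' 2 ≤ partWeight w κ 2 := by
  refine Finset.sum_le_sum fun x _ => ?_
  rcases h.weight x with hw | hw
  · by_cases hk : κ' x = 2
    · have := hκ' x
      rw [hk] at this
      have := eq_two_of_pos hθ hθ' hr hrr hr' (h.blue x hw) (h.neP x) (h.neS x) (h.sector x) this
        (hκ x)
      simp [hk, this]
    · simp only [hk, hw, if_false]
      split_ifs <;> simp
  · by_cases hk : κ x = 2
    · have := hκ x
      rw [hk] at this
      have := eq_two_of_outside hθ hθ' hr hrr hr' (h.neA x) (h.neP x) (h.neS x) (h.sector x)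
        (h.red x hw) this (hκ' x)
      simp [hk, this]
    · simp only [hk, hw, if_false]
      split_ifs <;> simp

/-- Each of the three rays contains at most one element. -/
lemma eq_of_two_parts (h : ThreeWayData w ξA ξP ξS tL tR) {θ r : ℝ} (hθ' : θ < 1)
    (hr' : r < 1) {κ₁ κ₂ : α → Fin 3} (h₁ : Adm ξA ξP ξS (θ, r) κ₁)
    (h₂ : Adm ξA ξP ξS (θ, r) κ₂) {i j : Fin 3} (hij : i ≠ j) (x y : α)
    (hx : (κ₁ x = i ∧ κ₂ x = j) ∨ (κ₁ x = j ∧ κ₂ x = i))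
    (hy : (κ₁ y = i ∧ κ₂ y = j) ∨ (κ₁ y = j ∧ κ₂ y = i)) : x = y := by
  have mem : ∀ {x}, ((κ₁ x = i ∧ κ₂ x = j) ∨ (κ₁ x = j ∧ κ₂ x = i)) →
      (θ, r) ∈ cone (ξA x) (ξP x) (ξS x) i ∧ (θ, r) ∈ cone (ξA x) (ξP x) (ξS x) j := by
    intro x hx
    have e1 := h₁ x
    have e2 := h₂ x
    rcases hx with ⟨a, b⟩ | ⟨a, b⟩ <;> rw [a] at e1 <;> rw [b] at e2
    · exact ⟨e1, e2⟩
    · exact ⟨e2, e1⟩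
  have hr1 : 1 - r ≠ 0 := by linarith
  have hθ1 : 1 - θ ≠ 0 := by linarith
  have l01 : ∀ {x y}, ((θ, r) ∈ cone (ξA x) (ξP x) (ξS x) 0 ∧
      (θ, r) ∈ cone (ξA x) (ξP x) (ξS x) 1) → ((θ, r) ∈ cone (ξA y) (ξP y) (ξS y) 0 ∧
      (θ, r) ∈ cone (ξA y) (ξP y) (ξS y) 1) → x = y := by
    rintro x y ⟨⟨-, a⟩, ⟨b, -⟩⟩ ⟨⟨-, c⟩, ⟨d, -⟩⟩
    have ex := le_antisymm b a
    have ey := le_antisymm d c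
    by_contra hne
    apply h.lineP x y hne
    apply mul_left_cancel₀ hθ1
    linear_combination ξA y * ex - ξA x * ey
  have l02 : ∀ {x y}, ((θ, r) ∈ cone (ξA x) (ξP x) (ξS x) 0 ∧
      (θ, r) ∈ cone (ξA x) (ξP x) (ξS x) 2) → ((θ, r) ∈ cone (ξA y) (ξP y) (ξS y) 0 ∧
      (θ, r) ∈ cone (ξA y) (ξP y) (ξS y) 2) → x = y := by
    rintro x y ⟨⟨a, -⟩, ⟨-, b⟩⟩ ⟨⟨c, -⟩, ⟨-, d⟩⟩
    have ex := le_antisymm b a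
    have ey := le_antisymm d c
    by_contra hne
    apply h.lineA x y hne
    apply mul_left_cancel₀ hr1
    linear_combination ξP y * ex - ξP x * ey
  have l12 : ∀ {x y}, ((θ, r) ∈ cone (ξA x) (ξP x) (ξS x) 1 ∧
      (θ, r) ∈ cone (ξA x) (ξP x) (ξS x) 2) → ((θ, r) ∈ cone (ξA y) (ξP y) (ξS y) 1 ∧
      (θ, r) ∈ cone (ξA y) (ξP y) (ξS y) 2) → x = y := by
    rintro x y ⟨⟨-, a⟩, ⟨b, -⟩⟩ ⟨⟨-, c⟩, ⟨d, -⟩⟩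
    have ex := le_antisymm b a
    have ey := le_antisymm d c
    by_contra hne
    apply h.lineS x y hne
    apply mul_left_cancel₀ hr1
    linear_combination ξP x * ey - ξP y * ex
  have mx := mem hx
  have my := mem hy
  fin_cases i <;> fin_cases j
  · exact absurd rfl hij
  · exact l01 mx my
  · exact l02 mx my
  · exact l01 mx.symm my.symm
  · exact absurd rfl hij
  · exact l12 mx my
  · exact l02 mx.symm my.symm
  · exact l12 mx.symm my.symm
  · exact absurd rfl hij

/-- On every ray from `P` there is a position of `c` for which part `2` has the required weight. -/
lemma exists_partWeight_two_eq (h : ThreeWayData w ξA ξP ξS tL tR) {θ : ℝ} (hθ : 0 ≤ θ)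
    (hθ' : θ < 1) :
    ∃ r, 0 < r ∧ r < 1 ∧ ∃ κ, Adm ξA ξP ξS (θ, r) κ ∧ partWeight w κ 2 = tR := by
  obtain ⟨κ₀, hκ₀⟩ := exists_adm (ξA := ξA) (ξP := ξP) (ξS := ξS) hθ hθ'.le zero_le_one
  obtain ⟨κ₁, hκ₁⟩ := exists_adm (ξA := ξA) (ξP := ξP) (ξS := ξS) hθ hθ'.le le_rfl
  have hcont : Continuous fun r : ℝ => (θ, r) := by fun_prop
  obtain ⟨r, hr, ⟨κ, hκ, hN⟩, ⟨κ', hκ', hN'⟩⟩ := exists_admissible_le_ge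
    (C := fun k x => (fun r : ℝ => (θ, r)) ⁻¹' cone (ξA x) (ξP x) (ξS x) k)
    (fun k x => (isClosed_cone _ _ _ k).preimage hcont) zero_le_one
    (fun r hr x => exists_mem_cone hθ hθ'.le hr.2) (fun κ => -partWeight w κ 2) (-tR)
    ⟨κ₀, hκ₀, neg_le_neg (h.lt_partWeight_two_of_left_end hκ₀).le⟩
    ⟨κ₁, hκ₁, neg_le_neg (h.partWeight_two_lt_of_right_end hθ hθ' hκ₁).le⟩
  replace hN : tR ≤ partWeight w κ 2 := neg_le_neg_iff.1 hN
  replace hN' : partWeight w κ' 2 ≤ tR := neg_le_neg_iff.1 hN'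
  change Adm ξA ξP ξS (θ, r) κ at hκ
  change Adm ξA ξP ξS (θ, r) κ' at hκ'
  have hr0 : 0 < r := by
    refine lt_of_le_of_ne hr.1 ?_
    rintro rfl
    exact absurd (h.lt_partWeight_two_of_left_end hκ') (not_lt.2 hN')
  have hr1 : r < 1 := by
    refine lt_of_le_of_ne hr.2 ?_
    rintro rfl
    exact absurd (h.partWeight_two_lt_of_right_end hθ hθ' hκ) (not_lt.2 hN)
  refine ⟨r, hr0, hr1, ?_⟩
  rcases hN.eq_or_lt with e | hlt
  · exact ⟨κ, hκ, e.symm⟩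
  rcases hN'.eq_or_lt with e | hlt'
  · exact ⟨κ', hκ', e⟩
  obtain ⟨κ'', hmix, heq, -⟩ := exists_partWeight_eq h.abs_weight (k := 2) (j := 0) (l := 1)
    (by decide) (by decide) (by decide) hlt' hlt
    (h.eq_of_two_parts hθ' hr1 hκ' hκ (by decide))
    (h.eq_of_two_parts hθ' hr1 hκ' hκ (by decide))
  refine ⟨κ'', fun x => ?_, heq⟩
  rcases hmix x with e | e <;> rw [e]
  · exact hκ' x
  · exact hκ x

/-- Some cut from a point `c` inside the triangle has the required weights. The cuts for which part
`2` has the right weight and part `0` too little, respectively too much, weight form closed sets.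
They are disjoint, meet every ray from `P` in an interval, and one of them meets the first and the
other one the last of these rays; so they cannot exhaust the cuts for which part `2` has the right
weight. -/
theorem exists_cut (h : ThreeWayData w ξA ξP ξS tL tR) :
    ∃ θ r : ℝ, 0 < θ ∧ θ < 1 ∧ 0 < r ∧ r < 1 ∧ ∃ κ, Adm ξA ξP ξS (θ, r) κ ∧
      partWeight w κ 0 = tL ∧ partWeight w κ 1 = 1 ∧ partWeight w κ 2 = tR := by
  -- On the side `P S` itself, red points beyond both `A S` and `P S` could be assigned to part `1`
  -- for `c = S`, and part `2` could get too much weight there.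
  -- The last ray stops short of `S`, so that part `1` has no element of weight `1` for it.
  obtain ⟨θ₁, hθ₁0, hθ₁1, hθ₁⟩ : ∃ θ₁ : ℝ, 0 < θ₁ ∧ θ₁ < 1 ∧
      ∀ x, 0 < ξA x → 0 < -(1 - θ₁) * ξS x + θ₁ * ξA x := by
    have h1 : ∀ᶠ θ : ℝ in 𝓝 1, ∀ x, 0 < ξA x → 0 < -(1 - θ) * ξS x + θ * ξA x := by
      rw [Filter.eventually_all]
      intro x
      by_cases hx : 0 < ξA x
      · have hc : Continuous fun θ : ℝ => -(1 - θ) * ξS x + θ * ξA x := by fun_prop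
        have : ∀ᶠ θ : ℝ in 𝓝 1, 0 < -(1 - θ) * ξS x + θ * ξA x :=
          hc.continuousAt.eventually (lt_mem_nhds (by simpa using hx))
        filter_upwards [this] with θ hθ _ using hθ
      · exact Eventually.of_forall fun θ hx' => absurd hx' hx
    have h2 : ∀ᶠ θ : ℝ in 𝓝[<] 1, 0 < θ := nhdsWithin_le_nhds (lt_mem_nhds one_pos)
    have h3 : ∀ᶠ θ : ℝ in 𝓝[<] 1, θ < 1 := self_mem_nhdsWithin
    obtain ⟨θ, ⟨ha, hb⟩, hc⟩ := (((h1.filter_mono nhdsWithin_le_nhds).and h2).and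
      h3).exists
    exact ⟨θ, hb, hc, ha⟩
  have hM₁ : ∀ {r κ}, Adm ξA ξP ξS (θ₁, r) κ → partWeight w κ 1 ≤ 0 := by
    intro r κ hκ
    refine Finset.sum_nonpos fun x _ => ?_
    split_ifs with hx
    · rcases h.weight x with hw | hw
      · have hm := hκ x
        rw [hx] at hm
        exact absurd hm.1 (not_le.2 (hθ₁ x (h.blue x hw)))
      · omega
    · exact le_rfl
  by_contra hcon
  have hno : ∀ {θ r κ}, θ ∈ Set.Icc 0 θ₁ → r ∈ Set.Icc (0 : ℝ) 1 → Adm ξA ξP ξS (θ, r) κ →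
      partWeight w κ 2 = tR → partWeight w κ 0 ≠ tL := by
    intro θ r κ hθ hr hκ h2 h0
    have htot := h.total
    rw [← sum_partWeight w κ] at htot
    have hθ1 : θ < 1 := hθ.2.trans_lt hθ₁1
    refine hcon ⟨θ, r, lt_of_le_of_ne hθ.1 ?_, hθ1, lt_of_le_of_ne hr.1 ?_,
      lt_of_le_of_ne hr.2 ?_, κ, hκ, h0, by omega, h2⟩
    · rintro rfl
      rcases hr.2.lt_or_eq with hlt | rfl
      · exact (h.partWeight_zero_lt_of_bottom hlt hκ).ne h0
      · exact (h.partWeight_two_lt_of_right_end le_rfl one_pos hκ).ne h2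
    · rintro rfl
      exact (h.lt_partWeight_two_of_left_end hκ).ne h2.symm
    · rintro rfl
      exact (h.partWeight_two_lt_of_right_end hθ.1 hθ1 hκ).ne h2
  have hr01 : ∀ {θ r κ}, θ ∈ Set.Icc 0 θ₁ → r ∈ Set.Icc (0 : ℝ) 1 → Adm ξA ξP ξS (θ, r) κ →
      partWeight w κ 2 = tR → 0 < r ∧ r < 1 := by
    intro θ r κ hθ hr hκ h2
    refine ⟨lt_of_le_of_ne hr.1 ?_, lt_of_le_of_ne hr.2 ?_⟩
    · rintro rfl
      exact (h.lt_partWeight_two_of_left_end hκ).ne h2.symm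
    · rintro rfl
      exact (h.partWeight_two_lt_of_right_end hθ.1 (hθ.2.trans_lt hθ₁1) hκ).ne h2
  set Few : Set (ℝ × ℝ) :=
    {y | ∃ κ, Adm ξA ξP ξS y κ ∧ (partWeight w κ 2 = tR ∧ partWeight w κ 0 < tL)} with hFew
  set Many : Set (ℝ × ℝ) :=
    {y | ∃ κ, Adm ξA ξP ξS y κ ∧ (partWeight w κ 2 = tR ∧ tL < partWeight w κ 0)} with hMany
  have hFewC : IsClosed Few :=
    isClosed_exists_admissible (fun k x => isClosed_cone _ _ _ k) _
  have hManyC : IsClosed Many :=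
    isClosed_exists_admissible (fun k x => isClosed_cone _ _ _ k) _
  have hdisj : ∀ {θ r}, θ ∈ Set.Icc 0 θ₁ → r ∈ Set.Icc (0 : ℝ) 1 → (θ, r) ∈ Few →
      (θ, r) ∉ Many := by
    rintro θ r hθ hr ⟨κ, hκ, h2, h0⟩ ⟨κ', hκ', h2', h0'⟩
    have hθ1 : θ < 1 := hθ.2.trans_lt hθ₁1
    obtain ⟨hr0, hr1⟩ := hr01 hθ hr hκ h2
    obtain ⟨κ'', hmix, heq, heq2⟩ := exists_partWeight_eq h.abs_weight (k := 0) (j := 1) (l := 2)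
      (by decide) (by decide) (by decide) h0 h0'
      (h.eq_of_two_parts hθ1 hr1 hκ hκ' (by decide))
      (h.eq_of_two_parts hθ1 hr1 hκ hκ' (by decide))
    refine hno (κ := κ'') hθ hr (fun x => ?_) (heq2.trans h2) heq
    rcases hmix x with e | e <;> rw [e]
    · exact hκ x
    · exact hκ' x
  have hsplit : ∀ {θ r κ}, θ ∈ Set.Icc 0 θ₁ → r ∈ Set.Icc (0 : ℝ) 1 → Adm ξA ξP ξS (θ, r) κ →
      partWeight w κ 2 = tR → (θ, r) ∈ Few ∨ (θ, r) ∈ Many := by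
    intro θ r κ hθ hr hκ h2
    rcases (hno hθ hr hκ h2).lt_or_gt with hlt | hlt
    · exact Or.inl ⟨κ, hκ, h2, hlt⟩
    · exact Or.inr ⟨κ, hκ, h2, hlt⟩
  -- On a single ray from `P`, only one of the two sets occurs.
  have hfibre : ∀ {θ r r'}, θ ∈ Set.Icc 0 θ₁ → r ∈ Set.Icc (0 : ℝ) 1 → r' ∈ Set.Icc (0 : ℝ) 1 →
      (θ, r) ∈ Few → (θ, r') ∉ Many := by
    intro θ r r' hθ hr hr' hF hM
    have hθ1 : θ < 1 := hθ.2.trans_lt hθ₁1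
    have hsub : Set.uIcc r r' ⊆ Set.Icc 0 1 := Set.uIcc_subset_Icc hr hr'
    have hcov : Set.uIcc r r' ⊆ (fun t : ℝ => (θ, t)) ⁻¹' Few ∪ (fun t : ℝ => (θ, t)) ⁻¹' Many := by
      intro t ht
      have ht01 := hsub ht
      -- by monotonicity, part `2` keeps its weight between the two positions
      have hbetween : ∀ {r₁ r₂ κ₁ κ₂}, r₁ ∈ Set.Icc (0 : ℝ) 1 → r₂ ∈ Set.Icc (0 : ℝ) 1 →
          r₁ ≤ t → t ≤ r₂ → Adm ξA ξP ξS (θ, r₁) κ₁ → partWeight w κ₁ 2 = tR →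
          Adm ξA ξP ξS (θ, r₂) κ₂ → partWeight w κ₂ 2 = tR → (θ, t) ∈ Few ∨ (θ, t) ∈ Many := by
        intro r₁ r₂ κ₁ κ₂ hr₁ hr₂ h1 h2 hκ₁ e1 hκ₂ e2
        rcases h1.eq_or_lt with rfl | h1
        · exact hsplit hθ hr₁ hκ₁ e1
        rcases h2.eq_or_lt with rfl | h2
        · exact hsplit hθ hr₂ hκ₂ e2
        obtain ⟨κ, hκ⟩ := exists_adm (ξA := ξA) (ξP := ξP) (ξS := ξS) hθ.1 hθ1.le ht01.2
        have hr₁0 := (hr01 hθ hr₁ hκ₁ e1).1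
        have hr₂1 := (hr01 hθ hr₂ hκ₂ e2).2
        refine hsplit hθ ht01 hκ (le_antisymm ?_ ?_)
        · exact e1 ▸ h.partWeight_two_le hθ.1 hθ1 hr₁0 h1 (h2.trans hr₂1) hκ₁ hκ
        · exact e2 ▸ h.partWeight_two_le hθ.1 hθ1 (hr₁0.trans h1) h2 hr₂1 hκ hκ₂
      obtain ⟨κ, hκ, e, -⟩ := hF
      obtain ⟨κ', hκ', e', -⟩ := hM
      rcases Set.mem_uIcc.1 ht with ⟨h1, h2⟩ | ⟨h1, h2⟩
      · exact hbetween hr hr' h1 h2 hκ e hκ' e'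
      · exact hbetween hr' hr h1 h2 hκ' e' hκ e
    have hcont : Continuous fun t : ℝ => (θ, t) := by fun_prop
    obtain ⟨t, ht, htF, htM⟩ := isPreconnected_closed_iff.1 (isPreconnected_uIcc (a := r) (b := r'))
      _ _ (hFewC.preimage hcont) (hManyC.preimage hcont) hcov ⟨r, Set.left_mem_uIcc, hF⟩
      ⟨r', Set.right_mem_uIcc, hM⟩
    exact hdisj hθ (hsub ht) htF htM
  -- The two sets project to closed sets that cover the interval of all rays.
  have hbox : IsCompact (Set.Icc 0 θ₁ ×ˢ Set.Icc (0 : ℝ) 1) := isCompact_Icc.prod isCompact_Icc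
  have hproj : ∀ {S : Set (ℝ × ℝ)}, IsClosed S →
      IsClosed (Prod.fst '' ((Set.Icc 0 θ₁ ×ˢ Set.Icc (0 : ℝ) 1) ∩ S)) := fun hS =>
    ((hbox.inter_right hS).image continuous_fst).isClosed
  have hzero : (0 : ℝ) ∈ Set.Icc 0 θ₁ := Set.left_mem_Icc.2 hθ₁0.le
  have hone : θ₁ ∈ Set.Icc 0 θ₁ := Set.right_mem_Icc.2 hθ₁0.le
  obtain ⟨θ, hθ, ⟨⟨_, r⟩, ⟨hy, hF⟩, rfl⟩, ⟨⟨_, r'⟩, ⟨hy', hM⟩, heq⟩⟩ :=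
    isPreconnected_closed_iff.1 (isPreconnected_Icc (a := 0) (b := θ₁)) _ _ (hproj hFewC)
      (hproj hManyC) (by
        intro θ hθ
        obtain ⟨r, hr0, hr1, κ, hκ, h2⟩ :=
          h.exists_partWeight_two_eq hθ.1 (hθ.2.trans_lt hθ₁1)
        have hr : r ∈ Set.Icc (0 : ℝ) 1 := ⟨hr0.le, hr1.le⟩
        rcases hsplit hθ hr hκ h2 with hm | hm
        · exact Or.inl ⟨(θ, r), ⟨⟨hθ, hr⟩, hm⟩, rfl⟩
        · exact Or.inr ⟨(θ, r), ⟨⟨hθ, hr⟩, hm⟩, rfl⟩)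
      (by
        obtain ⟨r, hr0, hr1, κ, hκ, h2⟩ := h.exists_partWeight_two_eq le_rfl one_pos
        exact ⟨0, hzero, (0, r), ⟨⟨hzero, hr0.le, hr1.le⟩, κ, hκ, h2,
          h.partWeight_zero_lt_of_bottom hr1 hκ⟩, rfl⟩)
      (by
        obtain ⟨r, hr0, hr1, κ, hκ, h2⟩ := h.exists_partWeight_two_eq hθ₁0.le hθ₁1
        refine ⟨θ₁, hone, (θ₁, r), ⟨⟨hone, hr0.le, hr1.le⟩, κ, hκ, h2, ?_⟩, rfl⟩
        have htot := h.total
        rw [← sum_partWeight w κ] at htot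
        have := hM₁ hκ
        omega)
  dsimp only at heq
  subst heq
  exact hfibre hθ hy.2 hy'.2 hF hM

end ThreeWayData

/-! ### Splitting a region along a chain -/

/-- The apex `a`, the convex chain `p 0, …, p s` and the coloured points `X`, with weight `1` on the
blue and `-1` on the red points. This collects what does not refer to the region that contains them:
convexity of the polygon `a, p 0, …, p s` (where `a` may be an end of the chain), the position of
the coloured points with respect to the chain, and general position. -/
structure ChainConfig (a : Plane) (p : ℕ → Plane) (s : ℕ) (X : Finset Plane) (w : Plane → ℤ) :
    Prop where
  chain : ∀ i j k, i < j → j < k → k ≤ s → orient (p i) (p j) (p k) < 0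
  apex_le : ∀ i j, i < j → j ≤ s → orient a (p i) (p j) ≤ 0
  apex_lt : ∀ i j, i < j → j ≤ s → a ≠ p i → a ≠ p j → orient a (p i) (p j) < 0
  apex_ne : ∀ i, 0 < i → i < s → a ≠ p i
  weight : ∀ x ∈ X, w x = 1 ∨ w x = -1
  blue : ∀ x ∈ X, w x = 1 → ∀ k, k + 1 ≤ s → orient (p k) (p (k + 1)) x < 0
  red : ∀ x ∈ X, w x = -1 → ∃ k, k + 1 ≤ s ∧ 0 < orient (p k) (p (k + 1)) x
  gen_apex : ∀ x ∈ X, ∀ y ∈ X, x ≠ y → orient a x y ≠ 0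
  gen_chain : ∀ x ∈ X, ∀ y ∈ X, x ≠ y → ∀ i, i ≤ s → orient (p i) x y ≠ 0
  gen_edge : ∀ x ∈ X, ∀ i, i + 1 ≤ s → orient (p i) (p (i + 1)) x ≠ 0
  gen_side : ∀ x ∈ X, ∀ i, i ≤ s → a ≠ p i → orient a (p i) x ≠ 0

/-- A region `Q` to be split along the part `p m, …, p n` of the chain, with the coloured points `Y`
that it has to account for. -/
structure IsPiece (a : Plane) (p : ℕ → Plane) (s : ℕ) (X : Finset Plane) (w : Plane → ℤ)
    (Q : Set Plane) (m n : ℕ) (Y : Finset Plane) : Prop where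
  region : IsConvexPolygonalRegion Q
  lt : m < n
  le : n ≤ s
  subset : Y ⊆ X
  mem : ∀ x ∈ Y, x ∈ Q
  apex_mem : a ∈ Q
  apex_bd : a ∉ interior Q
  chain_mem : ∀ j, m ≤ j → j ≤ n → p j ∈ Q
  first_bd : p m ∉ interior Q
  last_bd : p n ∉ interior Q
  total : ∑ x ∈ Y, w x = (n : ℤ) - m

/-- `Q` is the union of convex polygonal regions with disjoint interiors, one for each edge
`p j, p (j + 1)` with `m ≤ j < n`; the edge joins two boundary points of its region, and the points
of `Y` can be assigned to regions that contain them such that every region gets total weight `1`. -/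
def Splits (p : ℕ → Plane) (w : Plane → ℤ) (Q : Set Plane) (m n : ℕ) (Y : Finset Plane) : Prop :=
  ∃ (Qs : ℕ → Set Plane) (c : Plane → ℕ),
    (∀ j, m ≤ j → j < n → IsConvexPolygonalRegion (Qs j) ∧
      (p j ∈ Qs j ∧ p j ∉ interior (Qs j)) ∧ (p (j + 1) ∈ Qs j ∧ p (j + 1) ∉ interior (Qs j))) ∧
    (∀ x, x ∈ Q ↔ ∃ j, m ≤ j ∧ j < n ∧ x ∈ Qs j) ∧
    (∀ i j, m ≤ i → i < j → j < n → Disjoint (interior (Qs i)) (interior (Qs j))) ∧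
    (∀ x ∈ Y, m ≤ c x ∧ c x < n ∧ x ∈ Qs (c x)) ∧
    ∀ j, m ≤ j → j < n → (∑ x ∈ Y with c x = j, w x) = 1

lemma Splits.of_edge {p : ℕ → Plane} {w : Plane → ℤ} {Q : Set Plane} {m : ℕ} {Y : Finset Plane}
    (hQ : IsConvexPolygonalRegion Q) (hp : p m ∈ Q) (hp' : p m ∉ interior Q) (hq : p (m + 1) ∈ Q)
    (hq' : p (m + 1) ∉ interior Q) (hY : ∀ x ∈ Y, x ∈ Q) (htot : ∑ x ∈ Y, w x = 1) :
    Splits p w Q m (m + 1) Y := by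
  refine ⟨fun _ => Q, fun _ => m, ?_, ?_, ?_, ?_, ?_⟩
  · intro j h1 h2
    obtain rfl : j = m := by omega
    exact ⟨hQ, ⟨hp, hp'⟩, hq, hq'⟩
  · exact fun x => ⟨fun hx => ⟨m, le_rfl, by omega, hx⟩, fun ⟨_, _, _, hx⟩ => hx⟩
  · intro i j h1 h2 h3
    omega
  · exact fun x hx => ⟨le_rfl, Nat.lt_succ_self m, hY x hx⟩
  · intro j h1 h2
    obtain rfl : j = m := by omega
    simpa using htot

lemma disjoint_interior_of_subset {A B Q₁ Q₂ : Set Plane} (hA : A ⊆ Q₁) (hB : B ⊆ Q₂)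
    (h : interior (Q₁ ∩ Q₂) = ∅) : Disjoint (interior A) (interior B) := by
  rw [Set.disjoint_iff_inter_eq_empty, ← interior_inter, ← Set.subset_empty_iff, ← h]
  exact interior_mono (Set.inter_subset_inter hA hB)

lemma Splits.union {p : ℕ → Plane} {w : Plane → ℤ} {Q₁ Q₂ : Set Plane} {m i n : ℕ}
    {Y₁ Y₂ : Finset Plane} (h₁ : Splits p w Q₁ m i Y₁) (h₂ : Splits p w Q₂ i n Y₂) (hmi : m ≤ i)
    (hin : i ≤ n) (hdisj : interior (Q₁ ∩ Q₂) = ∅) (hY : Disjoint Y₁ Y₂) :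
    Splits p w (Q₁ ∪ Q₂) m n (Y₁ ∪ Y₂) := by
  classical
  obtain ⟨Qs, c, hr, hu, hd, hc, hw⟩ := h₁
  obtain ⟨Qs', c', hr', hu', hd', hc', hw'⟩ := h₂
  have hsub : ∀ j, m ≤ j → j < i → Qs j ⊆ Q₁ := fun j h1 h2 x hx => (hu x).2 ⟨j, h1, h2, hx⟩
  have hsub' : ∀ j, i ≤ j → j < n → Qs' j ⊆ Q₂ := fun j h1 h2 x hx => (hu' x).2 ⟨j, h1, h2, hx⟩
  have hnot : ∀ x ∈ Y₂, x ∉ Y₁ := fun x hx hx' => Finset.disjoint_left.1 hY hx' hx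
  refine ⟨fun j => if j < i then Qs j else Qs' j, fun x => if x ∈ Y₁ then c x else c' x,
    ?_, ?_, ?_, ?_, ?_⟩
  · intro j h1 h2
    by_cases hj : j < i
    · simpa only [hj, if_true] using hr j h1 hj
    · simpa only [hj, if_false] using hr' j (not_lt.1 hj) h2
  · intro x
    rw [Set.mem_union, hu, hu']
    constructor
    · rintro (⟨j, h1, h2, hx⟩ | ⟨j, h1, h2, hx⟩)
      · exact ⟨j, h1, by omega, by simpa only [h2, if_true] using hx⟩
      · exact ⟨j, by omega, h2, by simpa only [not_lt.2 h1, if_false] using hx⟩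
    · rintro ⟨j, h1, h2, hx⟩
      by_cases hj : j < i
      · exact Or.inl ⟨j, h1, hj, by simpa only [hj, if_true] using hx⟩
      · exact Or.inr ⟨j, not_lt.1 hj, h2, by simpa only [hj, if_false] using hx⟩
  · intro j k h1 h2 h3
    by_cases hj : j < i <;> by_cases hk : k < i
    · simpa only [hj, hk, if_true] using hd j k h1 h2 hk
    · simpa only [hj, hk, if_true, if_false] using
        disjoint_interior_of_subset (hsub j h1 hj) (hsub' k (not_lt.1 hk) h3) hdisj
    · omega
    · simpa only [hj, hk, if_false] using hd' j k (not_lt.1 hj) h2 h3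
  · intro x hx
    by_cases hx1 : x ∈ Y₁
    · obtain ⟨h1, h2, h3⟩ := hc x hx1
      simp only [hx1, if_true, h2]
      exact ⟨h1, by omega, h3⟩
    · obtain ⟨h1, h2, h3⟩ := hc' x ((Finset.mem_union.1 hx).resolve_left hx1)
      simp only [hx1, if_false, not_lt.2 h1]
      exact ⟨by omega, h2, h3⟩
  · intro j h1 h2
    rw [Finset.filter_union, Finset.sum_union (Finset.disjoint_filter_filter hY)]
    by_cases hj : j < i
    · have e1 : ({x ∈ Y₁ | (if x ∈ Y₁ then c x else c' x) = j} : Finset Plane) =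
          {x ∈ Y₁ | c x = j} := Finset.filter_congr fun x hx => by simp [hx]
      have e2 : ({x ∈ Y₂ | (if x ∈ Y₁ then c x else c' x) = j} : Finset Plane) = ∅ := by
        refine Finset.filter_eq_empty_iff.2 fun x hx => ?_
        have := (hc' x hx).1
        simp only [hnot x hx, if_false]
        omega
      rw [e1, e2, hw j h1 hj]
      simp
    · have e1 : ({x ∈ Y₁ | (if x ∈ Y₁ then c x else c' x) = j} : Finset Plane) = ∅ := by
        refine Finset.filter_eq_empty_iff.2 fun x hx => ?_
        have := (hc x hx).2.1
        simp only [hx, if_true]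
        omega
      have e2 : ({x ∈ Y₂ | (if x ∈ Y₁ then c x else c' x) = j} : Finset Plane) =
          {x ∈ Y₂ | c' x = j} := Finset.filter_congr fun x hx => by simp [hnot x hx]
      rw [e1, e2, hw' j (not_lt.1 hj) h2]
      simp

/-- Splitting the two parts of `Q` on the two sides of a line splits `Q`. -/
lemma Splits.of_line {p : ℕ → Plane} {w : Plane → ℤ} {Q : Set Plane} {u v : Plane} {m i n : ℕ}
    {Y Y₁ Y₂ : Finset Plane} (huv : u ≠ v) (h₁ : Splits p w (Q ∩ rightHalfPlane v u) m i Y₁)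
    (h₂ : Splits p w (Q ∩ rightHalfPlane u v) i n Y₂) (hmi : m ≤ i) (hin : i ≤ n)
    (hY : Disjoint Y₁ Y₂) (hYY : Y₁ ∪ Y₂ = Y) : Splits p w Q m n Y := by
  have h := h₁.union h₂ hmi hin (by
    rw [← Set.subset_empty_iff, ← interior_inter_opposite_halfPlanes huv]
    exact interior_mono fun x hx => ⟨hx.2.2, hx.1.2⟩) hY
  have hQ : Q ∩ rightHalfPlane v u ∪ Q ∩ rightHalfPlane u v = Q := by
    ext x
    simp only [Set.mem_union, Set.mem_inter_iff, mem_rightHalfPlane, orient_swap u v x]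
    constructor
    · rintro (h | h) <;> exact h.1
    · intro hx
      rcases le_total 0 (orient u v x) with h | h
      · exact Or.inl ⟨hx, by linarith⟩
      · exact Or.inr ⟨hx, h⟩
  rwa [hQ, hYY] at h

/-- The weight of the points of `Y` strictly to the left of the line from `a` to `q`. -/
noncomputable def leftWeight (a q : Plane) (w : Plane → ℤ) (Y : Finset Plane) : ℤ :=
  ∑ x ∈ Y with 0 < orient a q x, w x

lemma sum_subtype_ite (Y : Finset Plane) (w : Plane → ℤ) (P : Plane → Prop) [DecidablePred P] :
    (∑ x : Y, if P x then w x else 0) = ∑ x ∈ Y with P x, w x := by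
  rw [Finset.sum_filter]
  exact Finset.sum_coe_sort Y fun x => if P x then w x else 0

/-- An assignment of the elements of `Y`, turned into a function on the plane. -/
lemma exists_extension {ι : Type*} [DecidableEq ι] [Inhabited ι] (Y : Finset Plane)
    (w : Plane → ℤ) (κ : Y → ι) : ∃ K : Plane → ι, (∀ x : Y, K x = κ x) ∧
      ∀ k, ∑ x ∈ Y with K x = k, w x = partWeight (fun x : Y => w x) κ k := by
  classical
  obtain ⟨K, hK⟩ : ∃ K : Plane → ι, ∀ x : Y, K x = κ x :=
    ⟨fun x => if h : x ∈ Y then κ ⟨x, h⟩ else default, fun x => by simp⟩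
  refine ⟨K, hK, fun k => ?_⟩
  rw [← sum_subtype_ite Y w]
  exact Finset.sum_congr rfl fun x _ => by rw [hK]

/-! ### Cuts by a line -/

section Steps

variable {a : Plane} {p : ℕ → Plane} {s : ℕ} {X : Finset Plane} {w : Plane → ℤ} {Q : Set Plane}
  {m n i : ℕ} {Y : Finset Plane}

lemma notMem_interior_mono {S T : Set Plane} {x : Plane} (hx : x ∉ interior T) (h : S ⊆ T) :
    x ∉ interior S := fun hxS => hx (interior_mono h hxS)

lemma IsPiece.sum_add_sum (h : IsPiece a p s X w Q m n Y) (P : Plane → Prop) [DecidablePred P] :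
    (∑ x ∈ Y with P x, w x) + ∑ x ∈ Y with ¬P x, w x = (n : ℤ) - m := by
  rw [Finset.sum_filter_add_sum_filter_not, h.total]

/-- The points to the right and those to the left of the line from `a` to a vertex make up `Y`. -/
lemma IsPiece.sum_right (hc : ChainConfig a p s X w) (h : IsPiece a p s X w Q m n Y) (hi : i ≤ s)
    (ha : a ≠ p i) : ∑ x ∈ Y with orient a (p i) x < 0, w x =
      (n : ℤ) - m - leftWeight a (p i) w Y := by
  have h1 := h.sum_add_sum fun x => 0 < orient a (p i) x
  have h2 : ({x ∈ Y | ¬0 < orient a (p i) x} : Finset Plane) =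
      {x ∈ Y | orient a (p i) x < 0} := Finset.filter_congr fun x hx => by
    have := hc.gen_side x (h.subset hx) i hi ha
    rw [not_lt]
    exact ⟨fun h => lt_of_le_of_ne h this, le_of_lt⟩
  rw [h2] at h1
  unfold leftWeight
  linarith

lemma exists_mem_of_sum_pos {S : Finset Plane} (h : 0 < ∑ x ∈ S, w x) : ∃ x, x ∈ S := by
  by_contra hne
  push Not at hne
  rw [Finset.eq_empty_of_forall_notMem hne] at h
  simp at h

/-- If the line through the apex and a vertex halves the weight correctly, cut along it. -/
lemma IsPiece.splits_of_leftWeight_eq (hc : ChainConfig a p s X w)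
    (h : IsPiece a p s X w Q m n Y) (hmi : m < i) (hin : i < n)
    (hw : leftWeight a (p i) w Y = (i : ℤ) - m)
    (ih : ∀ Q' m' n' Y', n' - m' < n - m → IsPiece a p s X w Q' m' n' Y' → Splits p w Q' m' n' Y') :
    Splits p w Q m n Y := by
  have hns := h.le
  have ha : a ≠ p i := hc.apex_ne i (by omega) (by omega)
  have hr := h.sum_right hc (i := i) (by omega) ha
  have hipm := h.chain_mem i hmi.le hin.le
  have e1 : orient a (p i) a = 0 := orient_self_outer _ _
  have e2 : orient a (p i) (p i) = 0 := orient_self_right _ _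
  have e1' : orient (p i) a a = 0 := orient_self_right _ _
  have e2' : orient (p i) a (p i) = 0 := orient_self_outer _ _
  have hleft : ∀ x, orient (p i) a x = -orient a (p i) x := orient_swap _ _
  refine Splits.of_line (i := i) (Y₁ := {x ∈ Y | 0 < orient a (p i) x})
    (Y₂ := {x ∈ Y | orient a (p i) x < 0}) ha ?_ ?_ hmi.le hin.le ?_ ?_
  · obtain ⟨x, hx⟩ := exists_mem_of_sum_pos (w := w)
      (S := {x ∈ Y | 0 < orient a (p i) x}) (by
      change 0 < leftWeight a (p i) w Y
      omega)
    rw [Finset.mem_filter] at hx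
    refine ih _ m i _ (by omega) ⟨?_, hmi, by omega, (Finset.filter_subset _ _).trans h.subset, ?_,
      ⟨h.apex_mem, e1'.le⟩, notMem_interior_mono h.apex_bd Set.inter_subset_left, ?_,
      notMem_interior_mono h.first_bd Set.inter_subset_left,
      notMem_interior_of_subset_rightHalfPlane ha.symm Set.inter_subset_right e2', hw⟩
    · refine h.region.inter_of_triangle ha.symm (x := a) (y := p i) (z := x) ⟨h.apex_mem, e1'.le⟩
        ⟨hipm, e2'.le⟩ ⟨h.mem x hx.1, ?_⟩ hx.2.ne'
      rw [mem_rightHalfPlane, hleft]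
      linarith [hx.2]
    · intro y hy
      rw [Finset.mem_filter] at hy
      refine ⟨h.mem y hy.1, ?_⟩
      rw [mem_rightHalfPlane, hleft]
      linarith [hy.2]
    · intro j h1 h2
      refine ⟨h.chain_mem j h1 (by omega), ?_⟩
      rw [mem_rightHalfPlane]
      rcases h2.eq_or_lt with rfl | h2
      · exact e2'.le
      · rw [orient_rotate, orient_rotate]
        exact hc.apex_le j i h2 (by omega)
  · obtain ⟨x, hx⟩ := exists_mem_of_sum_pos (w := w)
      (S := {x ∈ Y | orient a (p i) x < 0}) (by omega)
    rw [Finset.mem_filter] at hx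
    refine ih _ i n _ (by omega) ⟨?_, hin, h.le, (Finset.filter_subset _ _).trans h.subset, ?_,
      ⟨h.apex_mem, e1.le⟩, notMem_interior_mono h.apex_bd Set.inter_subset_left, ?_,
      notMem_interior_of_subset_rightHalfPlane ha Set.inter_subset_right e2,
      notMem_interior_mono h.last_bd Set.inter_subset_left, by omega⟩
    · exact h.region.inter_of_triangle ha (x := a) (y := p i) (z := x) ⟨h.apex_mem, e1.le⟩
        ⟨hipm, e2.le⟩ ⟨h.mem x hx.1, hx.2.le⟩ hx.2.ne
    · intro y hy
      rw [Finset.mem_filter] at hy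
      exact ⟨h.mem y hy.1, hy.2.le⟩
    · intro j h1 h2
      refine ⟨h.chain_mem j (by omega) h2, ?_⟩
      rw [mem_rightHalfPlane]
      rcases h1.eq_or_lt with rfl | h1
      · exact e2.le
      · exact hc.apex_le i j h1 (by omega)
  · exact Finset.disjoint_filter.2 fun x _ h1 h2 => lt_asymm h1 h2
  · rw [← Finset.filter_or]
    refine Finset.filter_true_of_mem fun x hx => ?_
    exact (hc.gen_side x (h.subset hx) i (by omega) ha).symm.lt_or_gt

/-- The two-dimensional Binet–Cauchy identity. -/
lemma orient_mul_sub_orient_mul (u k l x y : Plane) :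
    orient u k x * orient u l y - orient u l x * orient u k y =
      orient u k l * orient u x y := by
  simp only [orient]; ring

/-- If the line from the apex to the second vertex has too much weight to its left, a line through
that vertex cuts off weight `1` together with the first edge. -/
lemma IsPiece.splits_of_lt_leftWeight (hc : ChainConfig a p s X w)
    (h : IsPiece a p s X w Q m n Y) (hmn : m + 1 < n) (hw : 1 < leftWeight a (p (m + 1)) w Y)
    (ih : ∀ Q' m' n' Y', n' - m' < n - m → IsPiece a p s X w Q' m' n' Y' → Splits p w Q' m' n' Y') :
    Splits p w Q m n Y := by
  classical
  have hns := h.le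
  have haS : a ≠ p (m + 1) := hc.apex_ne _ (by omega) (by omega)
  have haP : a ≠ p m := by
    rintro rfl
    -- no blue point is to the left of the edge
    refine absurd hw (not_lt.2 ?_)
    refine le_trans (Finset.sum_nonpos fun x hx => ?_) zero_le_one
    rw [Finset.mem_filter] at hx
    rcases hc.weight x (h.subset hx.1) with h1 | h1
    · exact absurd hx.2 (not_lt.2 (hc.blue x (h.subset hx.1) h1 m (by omega)).le)
    · omega
  have hD := hc.apex_lt m (m + 1) (by omega) (by omega) haP haS
  have hPmem := h.chain_mem m le_rfl (by omega)
  have hSmem := h.chain_mem (m + 1) (by omega) (by omega)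
  set P := p m with hP
  set S := p (m + 1) with hS
  obtain ⟨t, ht0, ht1, κ, hκT, hκF, hκ⟩ := exists_rotating_cut (w := fun x : Y => w x)
    (fun x => hc.weight x (h.subset x.2)) (g₀ := fun x : Y => orient P S x)
    (g₁ := fun x : Y => orient a S x) (fun x hx => hc.blue x (h.subset x.2) hx m (by omega))
    (fun x => hc.gen_side x (h.subset x.2) (m + 1) (by omega) haS)
    (by rw [sum_subtype_ite Y w fun x => 0 < orient a S x]; exact hw)
    (by
      intro x y hxy heq
      have h1 := orient_mul_sub_orient_mul S P a x y
      have h2 := hc.gen_chain x (h.subset x.2) y (h.subset y.2) (Subtype.coe_ne_coe.2 hxy) (m + 1)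
        (by omega)
      refine mul_ne_zero (a := orient S P a) ?_ h2 (h1.symm.trans ?_)
      · have : orient S P a = -orient a P S := by rw [orient_rotate a, orient_swap_right]
        rw [this]
        exact neg_ne_zero.2 hD.ne
      · rw [orient_swap P S, orient_swap P S, orient_swap a S, orient_swap a S]
        linarith)
  obtain ⟨K, hK, hKw⟩ := exists_extension Y w κ
  set e : Plane := (1 - t) • P + t • a with he
  have hor : ∀ x, orient e S x = (1 - t) * orient P S x + t * orient a S x :=
    orient_lineMap_left t P a S
  have heQ : e ∈ Q := h.region.convex hPmem h.apex_mem (by linarith) ht0.le (by ring)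
  have heP : 0 < orient e S P := by
    have h1 : orient a S P = -orient a P S := orient_swap_right _ _ _
    rw [hor, orient_self_outer, h1]
    nlinarith
  have heS : e ≠ S := by
    intro h0
    rw [h0, orient_self_left] at heP
    exact lt_irrefl _ heP
  have hneg : ∀ x, orient S e x = -orient e S x := orient_swap _ _
  have hea : orient e S a ≤ 0 := by
    have h1 : orient P S a = orient a P S := orient_rotate _ _ _
    rw [hor, orient_self_outer, h1]
    nlinarith
  have hchain : ∀ j, m + 1 < j → j ≤ n → orient e S (p j) < 0 := by
    intro j h1 h2
    have e1 := hc.chain m (m + 1) j (by omega) h1 (by omega)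
    have e2 := hc.apex_le (m + 1) j h1 (by omega)
    rw [hor]
    nlinarith
  refine Splits.of_line (i := m + 1) (Y₁ := {x ∈ Y | K x = true}) (Y₂ := {x ∈ Y | K x = false})
    heS ?_ ?_ (by omega) hmn.le ?_ ?_
  · refine Splits.of_edge ?_ ⟨hPmem, ?_⟩ (notMem_interior_mono h.first_bd Set.inter_subset_left)
      ⟨hSmem, ?_⟩ (notMem_interior_of_subset_rightHalfPlane heS.symm Set.inter_subset_right
        (orient_self_outer _ _)) ?_ ?_
    · refine h.region.inter_of_triangle heS.symm (x := e) (y := S) (z := P)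
        ⟨heQ, (orient_self_right _ _).le⟩ ⟨hSmem, (orient_self_outer _ _).le⟩ ⟨hPmem, ?_⟩ heP.ne'
      rw [mem_rightHalfPlane, hneg]; linarith
    · rw [mem_rightHalfPlane, hneg]; linarith
    · exact (orient_self_outer _ _).le
    · intro x hx
      rw [Finset.mem_filter] at hx
      have := hκT ⟨x, hx.1⟩ (by rw [← hK]; exact hx.2)
      refine ⟨h.mem x hx.1, ?_⟩
      rw [mem_rightHalfPlane, hneg, hor]
      linarith
    · rw [hKw, hκ]
  · have hsum := h.sum_add_sum fun x => K x = true
    rw [hKw, hκ] at hsum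
    simp only [Bool.not_eq_true] at hsum
    refine ih _ (m + 1) n _ (by omega) ⟨?_, hmn, h.le, (Finset.filter_subset _ _).trans h.subset,
      ?_,
      ⟨h.apex_mem, hea⟩, notMem_interior_mono h.apex_bd Set.inter_subset_left, ?_,
      notMem_interior_of_subset_rightHalfPlane heS Set.inter_subset_right (orient_self_right _ _),
      notMem_interior_mono h.last_bd Set.inter_subset_left, by push_cast; linarith⟩
    · exact h.region.inter_of_triangle heS (x := e) (y := S) (z := p (m + 2))
        ⟨heQ, (orient_self_outer _ _).le⟩ ⟨hSmem, (orient_self_right _ _).le⟩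
        ⟨h.chain_mem _ (by omega) (by omega), (hchain _ (by omega) (by omega)).le⟩
        (hchain _ (by omega) (by omega)).ne
    · intro x hx
      rw [Finset.mem_filter] at hx
      have := hκF ⟨x, hx.1⟩ (by rw [← hK]; exact hx.2)
      refine ⟨h.mem x hx.1, ?_⟩
      rw [mem_rightHalfPlane, hor]
      exact this
    · intro j h1 h2
      refine ⟨h.chain_mem j (by omega) h2, ?_⟩
      rcases h1.eq_or_lt with rfl | h1
      · exact (orient_self_right _ _).le
      · exact (hchain j h1 h2).le
  · exact Finset.disjoint_filter.2 fun x _ h1 h2 => by simp [h1] at h2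
  · rw [← Finset.filter_or]
    exact Finset.filter_true_of_mem fun x _ => by cases K x <;> simp

/-- If the line from the apex to the last but one vertex has too little weight to its left, a line
through that vertex cuts off weight `1` together with the last edge. -/
lemma IsPiece.splits_of_leftWeight_lt (hc : ChainConfig a p s X w)
    (h : IsPiece a p s X w Q m (i + 1) Y) (hmi : m < i)
    (hw : leftWeight a (p i) w Y < (i : ℤ) - m)
    (ih : ∀ Q' m' n' Y', n' - m' < i + 1 - m → IsPiece a p s X w Q' m' n' Y' →
      Splits p w Q' m' n' Y') :
    Splits p w Q m (i + 1) Y := by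
  classical
  have hns := h.le
  have haS : a ≠ p i := hc.apex_ne _ (by omega) (by omega)
  have hright := h.sum_right hc (i := i) (by omega) haS
  have haP : a ≠ p (i + 1) := by
    rintro rfl
    -- no blue point is to the left of the edge
    have hle : ∑ x ∈ Y with orient (p (i + 1)) (p i) x < 0, w x ≤ 0 := by
      refine Finset.sum_nonpos fun x hx => ?_
      rw [Finset.mem_filter, orient_swap] at hx
      rcases hc.weight x (h.subset hx.1) with h1 | h1
      · have := hc.blue x (h.subset hx.1) h1 i (by omega)
        linarith [hx.2]
      · omega
    push_cast at hright
    omega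
  have hD := hc.apex_lt i (i + 1) (by omega) (by omega) haS haP
  have hPmem := h.chain_mem (i + 1) (by omega) (by omega)
  have hSmem := h.chain_mem i (by omega) (by omega)
  set P := p (i + 1) with hP
  set S := p i with hS
  obtain ⟨t, ht0, ht1, κ, hκT, hκF, hκ⟩ := exists_rotating_cut (w := fun x : Y => w x)
    (fun x => hc.weight x (h.subset x.2)) (g₀ := fun x : Y => orient S P x)
    (g₁ := fun x : Y => orient S a x) (fun x hx => hc.blue x (h.subset x.2) hx i (by omega))
    (fun x => by
      rw [orient_swap]
      exact neg_ne_zero.2 (hc.gen_side x (h.subset x.2) i (by omega) haS))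
    (by
      rw [sum_subtype_ite Y w fun x => 0 < orient S a x]
      have : ∀ x, 0 < orient S a x ↔ orient a S x < 0 := fun x => by
        rw [orient_swap]; exact neg_pos
      simp only [this, hright]
      push_cast
      omega)
    (by
      intro x y hxy heq
      have h1 := orient_mul_sub_orient_mul S P a x y
      have h2 := hc.gen_chain x (h.subset x.2) y (h.subset y.2) (Subtype.coe_ne_coe.2 hxy) i
        (by omega)
      refine mul_ne_zero (a := orient S P a) ?_ h2 (h1.symm.trans (sub_eq_zero.2 heq))
      have : orient S P a = orient a S P := orient_rotate _ _ _
      rw [this]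
      exact hD.ne)
  obtain ⟨K, hK, hKw⟩ := exists_extension Y w κ
  set e : Plane := (1 - t) • P + t • a with he
  have hor : ∀ x, orient S e x = (1 - t) * orient S P x + t * orient S a x :=
    orient_lineMap_mid t P a S
  have heQ : e ∈ Q := h.region.convex hPmem h.apex_mem (by linarith) ht0.le (by ring)
  have heP : 0 < orient S e P := by
    have h1 : orient S a P = -orient a S P := orient_swap _ _ _
    rw [hor, orient_self_right, h1]
    nlinarith
  have heS : S ≠ e := by
    intro h0
    rw [← h0, orient_self_left] at heP
    exact lt_irrefl _ heP
  have hneg : ∀ x, orient e S x = -orient S e x := orient_swap _ _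
  have hea : orient S e a ≤ 0 := by
    have h1 : orient S P a = orient a S P := orient_rotate _ _ _
    rw [hor, orient_self_right, h1]
    nlinarith
  have hchain : ∀ j, m ≤ j → j < i → orient S e (p j) < 0 := by
    intro j h1 h2
    have e1 := hc.chain j i (i + 1) h2 (by omega) (by omega)
    have e2 := hc.apex_le j i h2 (by omega)
    have e3 : orient S P (p j) = orient (p j) S P := orient_rotate _ _ _
    have e4 : orient S a (p j) = orient a (p j) S := (orient_rotate _ _ _).symm
    rw [hor, e3, e4]
    nlinarith
  refine Splits.of_line (i := i) (Y₁ := {x ∈ Y | K x = false}) (Y₂ := {x ∈ Y | K x = true})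
    heS.symm ?_ ?_ hmi.le (by omega) ?_ ?_
  · have hsum := h.sum_add_sum fun x => K x = true
    rw [hKw, hκ] at hsum
    simp only [Bool.not_eq_true] at hsum
    refine ih _ m i _ (by omega) ⟨?_, hmi, by omega, (Finset.filter_subset _ _).trans h.subset, ?_,
      ⟨h.apex_mem, hea⟩, notMem_interior_mono h.apex_bd Set.inter_subset_left, ?_,
      notMem_interior_mono h.first_bd Set.inter_subset_left,
      notMem_interior_of_subset_rightHalfPlane heS Set.inter_subset_right (orient_self_outer _ _),
      by push_cast at hsum; linarith⟩
    · exact h.region.inter_of_triangle heS (x := S) (y := e) (z := p m)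
        ⟨hSmem, (orient_self_outer _ _).le⟩ ⟨heQ, (orient_self_right _ _).le⟩
        ⟨h.chain_mem _ le_rfl (by omega), (hchain _ le_rfl hmi).le⟩ (hchain _ le_rfl hmi).ne
    · intro x hx
      rw [Finset.mem_filter] at hx
      have := hκF ⟨x, hx.1⟩ (by rw [← hK]; exact hx.2)
      refine ⟨h.mem x hx.1, ?_⟩
      rw [mem_rightHalfPlane, hor]
      exact this
    · intro j h1 h2
      refine ⟨h.chain_mem j h1 (by omega), ?_⟩
      rcases h2.eq_or_lt with rfl | h2
      · exact (orient_self_outer _ _).le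
      · exact (hchain j h1 h2).le
  · refine Splits.of_edge ?_ ⟨hSmem, (orient_self_right _ _).le⟩
      (notMem_interior_of_subset_rightHalfPlane heS.symm Set.inter_subset_right
        (orient_self_right _ _)) ⟨hPmem, ?_⟩
      (notMem_interior_mono h.last_bd Set.inter_subset_left) ?_ ?_
    · refine h.region.inter_of_triangle heS.symm (x := S) (y := e) (z := P)
        ⟨hSmem, (orient_self_right _ _).le⟩ ⟨heQ, (orient_self_outer _ _).le⟩ ⟨hPmem, ?_⟩ heP.ne'
      rw [mem_rightHalfPlane, hneg]; linarith
    · rw [mem_rightHalfPlane, hneg]; linarith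
    · intro x hx
      rw [Finset.mem_filter] at hx
      have := hκT ⟨x, hx.1⟩ (by rw [← hK]; exact hx.2)
      refine ⟨h.mem x hx.1, ?_⟩
      rw [mem_rightHalfPlane, hneg, hor]
      linarith
    · rw [hKw, hκ]
  · exact Finset.disjoint_filter.2 fun x _ h1 h2 => by simp [h1] at h2
  · rw [← Finset.filter_or]
    exact Finset.filter_true_of_mem fun x _ => by cases K x <;> simp

/-! ### Cuts by three rays -/

/-- The part of `Q` in the cone with apex `c` that lies clockwise from the ray `c u` and
counterclockwise from the ray `c v`. -/
def sector (Q : Set Plane) (c u v : Plane) : Set Plane :=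
  (Q ∩ rightHalfPlane c u) ∩ rightHalfPlane v c

lemma mem_sector {c u v x : Plane} :
    x ∈ sector Q c u v ↔ x ∈ Q ∧ orient c u x ≤ 0 ∧ 0 ≤ orient c v x := by
  simp only [sector, Set.mem_inter_iff, mem_rightHalfPlane, orient_swap c v x, and_assoc,
    neg_nonpos]

lemma sector_subset {c u v : Plane} : sector Q c u v ⊆ Q := fun _ hx => hx.1.1

lemma ne_of_orient_neg {c u v : Plane} (h : orient c u v < 0) : c ≠ u ∧ c ≠ v := by
  constructor <;> rintro rfl
  · exact h.ne (orient_self_left _ _)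
  · exact h.ne (orient_self_outer _ _)

lemma left_mem_sector {c u v : Plane} (hu : u ∈ Q) (h : orient c u v < 0) : u ∈ sector Q c u v := by
  refine mem_sector.2 ⟨hu, (orient_self_right _ _).le, ?_⟩
  have : orient c v u = -orient c u v := orient_swap_right _ _ _
  linarith

lemma right_mem_sector {c u v : Plane} (hv : v ∈ Q) (h : orient c u v < 0) : v ∈ sector Q c u v :=
  mem_sector.2 ⟨hv, h.le, (orient_self_right _ _).ge⟩

lemma left_notMem_interior_sector {c u v : Plane} (h : orient c u v < 0) :
    u ∉ interior (sector Q c u v) :=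
  notMem_interior_of_subset_rightHalfPlane (ne_of_orient_neg h).1 (fun _ hx => hx.1.2)
    (orient_self_right _ _)

lemma right_notMem_interior_sector {c u v : Plane} (h : orient c u v < 0) :
    v ∉ interior (sector Q c u v) :=
  notMem_interior_of_subset_rightHalfPlane (ne_of_orient_neg h).2.symm (fun _ hx => hx.2)
    (orient_self_outer _ _)

lemma isConvexPolygonalRegion_sector (hQ : IsConvexPolygonalRegion Q) {c u v : Plane} (hc : c ∈ Q)
    (hu : u ∈ Q) (hv : v ∈ Q) (h : orient c u v < 0) :
    IsConvexPolygonalRegion (sector Q c u v) := by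
  have hne := ne_of_orient_neg h
  have hu' := left_mem_sector hu h
  have hv' := right_mem_sector hv h
  have hc' : c ∈ sector Q c u v :=
    mem_sector.2 ⟨hc, (orient_self_outer _ _).le, (orient_self_outer _ _).ge⟩
  exact (hQ.inter_of_triangle hne.1 hc'.1 hu'.1 hv'.1 h.ne).inter_of_triangle hne.2.symm hc' hu' hv'
    h.ne

/-- Neighbouring sectors overlap only in the line through their common ray. -/
lemma interior_sector_inter_sector {c u v z : Plane} (huv : c ≠ v) :
    interior (sector Q c u v ∩ sector Q c v z) = ∅ := by
  rw [← Set.subset_empty_iff, ← interior_inter_opposite_halfPlanes huv]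
  exact interior_mono fun x hx => ⟨hx.2.1.2, hx.1.2⟩

/-- If the line from the apex to `p i` has too little, and the line to `p (i + 1)` too much weight
to its left, cut along three rays from a point of the triangle `a, p i, p (i + 1)` to its
vertices. -/
lemma IsPiece.splits_of_leftWeight_lt_of_lt (hc : ChainConfig a p s X w)
    (h : IsPiece a p s X w Q m n Y) (hmi : m < i) (hin : i + 1 < n)
    (hw : leftWeight a (p i) w Y < (i : ℤ) - m)
    (hw' : (i : ℤ) + 1 - m < leftWeight a (p (i + 1)) w Y)
    (ih : ∀ Q' m' n' Y', n' - m' < n - m → IsPiece a p s X w Q' m' n' Y' → Splits p w Q' m' n' Y') :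
    Splits p w Q m n Y := by
  classical
  have hns := h.le
  have haP : a ≠ p i := hc.apex_ne _ (by omega) (by omega)
  have haS : a ≠ p (i + 1) := hc.apex_ne _ (by omega) (by omega)
  have hright := h.sum_right hc (i := i + 1) (by omega) haS
  have hD := hc.apex_lt i (i + 1) (by omega) (by omega) haP haS
  have hPmem := h.chain_mem i (by omega) (by omega)
  have hSmem := h.chain_mem (i + 1) (by omega) (by omega)
  have hright_edge : ∀ j k, j ≤ s → k + 1 ≤ s → orient (p k) (p (k + 1)) (p j) ≤ 0 := by
    intro j k hj hk
    rcases lt_trichotomy j k with h1 | rfl | h1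
    · have e1 := hc.chain j k (k + 1) h1 (by omega) hk
      have e2 : orient (p k) (p (k + 1)) (p j) = orient (p j) (p k) (p (k + 1)) :=
      orient_rotate _ _ _
      linarith
    · exact (orient_self_outer _ _).le
    · rcases (Nat.succ_le_of_lt h1).eq_or_lt with rfl | h1
      · exact (orient_self_right _ _).le
      · exact (hc.chain k (k + 1) j (by omega) h1 hj).le
  obtain ⟨P, hP⟩ : ∃ P, P = p i := ⟨_, rfl⟩
  obtain ⟨S, hS⟩ : ∃ S, S = p (i + 1) := ⟨_, rfl⟩
  have hright_a : ∀ k, k + 1 ≤ s → orient (p k) (p (k + 1)) a ≤ 0 := by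
    intro k hk
    have e1 := hc.apex_le k (k + 1) (by omega) hk
    have e2 : orient (p k) (p (k + 1)) a = orient a (p k) (p (k + 1)) :=
      orient_rotate _ _ _
    linarith
  have hrightS : ∀ k, k + 1 ≤ s → orient (p k) (p (k + 1)) S ≤ 0 :=
    fun k hk => hS ▸ hright_edge (i + 1) k (by omega) hk
  have hrightP : ∀ k, k + 1 ≤ s → orient (p k) (p (k + 1)) P ≤ 0 :=
    fun k hk => hP ▸ hright_edge i k (by omega) hk
  rw [← hP] at hw haP hPmem
  rw [← hS] at hw' hright haS hSmem
  rw [← hP, ← hS] at hD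
  have hdata : ThreeWayData (fun x : Y => w x) (fun x : Y => -orient P S x)
      (fun x : Y => orient a S x) (fun x : Y => -orient a P x) ((i : ℤ) - m)
      ((n : ℤ) - i - 1) := by
    have hgc : ∀ x : Y, ∀ y : Y, x ≠ y → ∀ j, j ≤ s → orient (p j) x y ≠ 0 := fun x y hxy =>
      hc.gen_chain x (h.subset x.2) y (h.subset y.2) (Subtype.coe_ne_coe.2 hxy)
    refine ⟨fun x => hc.weight x (h.subset x.2), fun x => ?_, fun x => ?_, fun x => ?_,
      fun x hx => ?_, fun x hx => ?_, fun x => ?_, fun x y hxy heq => ?_, fun x y hxy heq => ?_,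
      fun x y hxy heq => ?_, ?_, ?_, ?_⟩
    · exact neg_ne_zero.2 (hP ▸ hS ▸ hc.gen_edge x (h.subset x.2) i (by omega))
    · exact hS ▸ hc.gen_side x (h.subset x.2) (i + 1) (by omega) (hS ▸ haS)
    · exact neg_ne_zero.2 (hP ▸ hc.gen_side x (h.subset x.2) i (by omega) (hP ▸ haP))
    · have := hc.blue x (h.subset x.2) hx i (by omega)
      rw [← hP, ← hS] at this
      linarith
    · rintro ⟨h1, h2, h3⟩
      obtain ⟨k, hk, hpos⟩ := hc.red x (h.subset x.2) hx
      have e1 := orient_barycentric a P S x (p k) (p (k + 1))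
      have e2 : orient S a x = -orient a S x := orient_swap _ _ _
      rw [e2] at e1
      nlinarith [hright_a k hk, hrightS k hk, hrightP k hk, mul_neg_of_neg_of_pos hD hpos,
        mul_nonneg h1.le (neg_nonneg.2 (hright_a k hk)),
        mul_nonneg h2.le (neg_nonneg.2 (hrightP k hk)),
        mul_nonneg h3.le (neg_nonneg.2 (hrightS k hk))]
    · rintro ⟨h1, h2⟩
      -- otherwise `a` would be inside the triangle `P S x`
      refine h.apex_bd (mem_interior_of_orient_neg h.region.convex hPmem hSmem (h.mem x x.2)
        ?_ ?_ ?_)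
      · have : orient P S a = orient a P S := orient_rotate _ _ _
        linarith
      · have : orient S x a = orient a S x := orient_rotate _ _ _
        linarith
      · have : orient (x : Plane) P a = -orient a P x := by simp only [orient]; ring
        linarith
    · have h1 := orient_mul_sub_orient_mul a P S x y
      refine mul_ne_zero hD.ne (hc.gen_apex x (h.subset x.2) y (h.subset y.2)
        (Subtype.coe_ne_coe.2 hxy)) (h1.symm.trans ?_)
      linarith
    · have h1 := orient_mul_sub_orient_mul P S a x y
      have h2 : orient P S a = orient a P S := orient_rotate _ _ _
      rw [h2, orient_swap a P, orient_swap a P] at h1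
      refine mul_ne_zero hD.ne (hP ▸ hgc x y hxy i (by omega)) (h1.symm.trans ?_)
      linarith
    · have h1 := orient_mul_sub_orient_mul S a P x y
      have h2 : orient S a P = orient a P S := (orient_rotate _ _ _).symm
      rw [h2, orient_swap a S, orient_swap a S, orient_swap P S, orient_swap P S] at h1
      refine mul_ne_zero hD.ne (hS ▸ hgc x y hxy (i + 1) (by omega)) (h1.symm.trans ?_)
      linarith
    · rw [Finset.sum_coe_sort Y w, h.total]
      ring
    · rw [sum_subtype_ite Y w fun x => -orient a P x < 0]
      simp only [neg_lt_zero]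
      exact hw
    · rw [sum_subtype_ite Y w fun x => orient a S x < 0]
      linarith
  obtain ⟨θ, r, hθ0, hθ1, hr0, hr1, κ, hκ, hw0, hw1, hw2⟩ := hdata.exists_cut
  obtain ⟨K, hK, hKw⟩ := exists_extension Y w κ
  obtain ⟨c, hcdef⟩ : ∃ c : Plane, c = (1 - r) • P + r • ((1 - θ) • a + θ • S) := ⟨_, rfl⟩
  have hcQ : c ∈ Q := by
    rw [hcdef]
    exact h.region.convex hPmem (h.region.convex h.apex_mem hSmem (by linarith) hθ0.le (by ring))
      (by linarith) hr0.le (by ring)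
  have hcP : ∀ x, orient c P x = r * ((1 - θ) * orient a P x + θ * -orient P S x) := by
    intro x
    rw [hcdef, orient_lineMap_left, orient_lineMap_left, orient_self_left, orient_swap P S]
    ring
  have hcS : ∀ x, orient c S x = (1 - r) * orient P S x + r * (1 - θ) * orient a S x := by
    intro x
    rw [hcdef, orient_lineMap_left, orient_lineMap_left, orient_self_left]
    ring
  have hca : ∀ x, orient c a x = -((1 - r) * orient a P x + r * θ * orient a S x) := by
    intro x
    rw [orient_swap, hcdef, orient_lineMap_mid, orient_lineMap_mid, orient_self_left]
    ring
  have hPSa : orient P S a = orient a P S := orient_rotate _ _ _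
  have haSP : orient a S P = -orient a P S := orient_swap_right _ _ _
  have hD0 : orient c a P < 0 := by
    rw [hca, orient_self_right, haSP]
    nlinarith [mul_pos hr0 hθ0]
  have hD1 : orient c P S < 0 := by
    rw [hcP, orient_self_right]
    nlinarith [mul_pos hr0 (sub_pos.2 hθ1)]
  have hD2 : orient c S a < 0 := by
    rw [hcS, orient_self_outer, hPSa]
    nlinarith
  have hcone : ∀ {x : Plane}, x ∈ Q → ∀ {k}, (θ, r) ∈ cone (-orient P S x) (orient a S x)
      (-orient a P x) k →
      x ∈ (![sector Q c a P, sector Q c P S, sector Q c S a] k : Set Plane) := by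
    intro x hx k hk
    fin_cases k
    · obtain ⟨h1, h2⟩ := mem_cone_zero.1 hk
      refine mem_sector.2 ⟨hx, ?_, ?_⟩
      · rw [hca]; linarith
      · rw [hcP]; exact mul_nonneg hr0.le (by linarith)
    · obtain ⟨h1, h2⟩ := mem_cone_one.1 hk
      refine mem_sector.2 ⟨hx, ?_, ?_⟩
      · rw [hcP]; exact mul_nonpos_of_nonneg_of_nonpos hr0.le (by linarith)
      · rw [hcS]; linarith
    · obtain ⟨h1, h2⟩ := mem_cone_two.1 hk
      refine mem_sector.2 ⟨hx, ?_, ?_⟩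
      · rw [hcS]; linarith
      · rw [hca]; linarith
  have hYmem : ∀ k, ∀ x ∈ ({x ∈ Y | K x = k} : Finset Plane),
      x ∈ (![sector Q c a P, sector Q c P S, sector Q c S a] k : Set Plane) := by
    intro k x hx
    rw [Finset.mem_filter] at hx
    refine hcone (h.mem x hx.1) ?_
    have := hκ ⟨x, hx.1⟩
    rwa [show κ ⟨x, hx.1⟩ = k by rw [← hK]; exact hx.2] at this
  have hYsub : ∀ k, ({x ∈ Y | K x = k} : Finset Plane) ⊆ X := fun k =>
    (Finset.filter_subset _ _).trans h.subset
  have hsplit0 : Splits p w (sector Q c a P) m i {x ∈ Y | K x = 0} := by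
    refine ih _ m i _ (by omega) ⟨isConvexPolygonalRegion_sector h.region hcQ h.apex_mem hPmem hD0,
      hmi, by omega, hYsub 0, hYmem 0, left_mem_sector h.apex_mem hD0,
      left_notMem_interior_sector hD0, fun j h1 h2 => ?_,
      notMem_interior_mono h.first_bd sector_subset, hP ▸ right_notMem_interior_sector hD0, ?_⟩
    · have e1 : 0 ≤ orient a P (p j) := by
        rcases h2.eq_or_lt with rfl | h2
        · rw [← hP, orient_self_right]
        · have e1 := hc.apex_le j i h2 (by omega)
          have e2 : orient a (p i) (p j) = -orient a (p j) (p i) := orient_swap_right _ _ _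
          rw [hP, e2]
          linarith
      have e2 : 0 ≤ orient a S (p j) := by
        have e1 := hc.apex_le j (i + 1) (by omega) (by omega)
        have e2 : orient a (p (i + 1)) (p j) = -orient a (p j) (p (i + 1)) :=
      orient_swap_right _ _ _
        rw [hS, e2]
        linarith
      have e3 : orient P S (p j) ≤ 0 := by
        rw [hP, hS]
        exact hright_edge j i (by omega) (by omega)
      refine mem_sector.2 ⟨h.chain_mem j h1 (by omega), ?_, ?_⟩
      · rw [hca]
        nlinarith [mul_nonneg (mul_pos hr0 hθ0).le e2, mul_nonneg (sub_pos.2 hr1).le e1]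
      · rw [hcP]
        exact mul_nonneg hr0.le (add_nonneg (mul_nonneg (sub_pos.2 hθ1).le e1)
          (mul_nonneg hθ0.le (neg_nonneg.2 e3)))
    · rw [hKw, hw0]
  have hsplit1 : Splits p w (sector Q c P S) i (i + 1) {x ∈ Y | K x = 1} := by
    refine Splits.of_edge (isConvexPolygonalRegion_sector h.region hcQ hPmem hSmem hD1) ?_ ?_ ?_ ?_
      (hYmem 1) ?_
    · exact hP ▸ left_mem_sector hPmem hD1
    · exact hP ▸ left_notMem_interior_sector hD1
    · exact hS ▸ right_mem_sector hSmem hD1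
    · exact hS ▸ right_notMem_interior_sector hD1
    · rw [hKw, hw1]
  have hsplit2 : Splits p w (sector Q c S a) (i + 1) n {x ∈ Y | K x = 2} := by
    refine ih _ (i + 1) n _ (by omega)
      ⟨isConvexPolygonalRegion_sector h.region hcQ hSmem h.apex_mem hD2,
      hin, h.le, hYsub 2, hYmem 2, right_mem_sector h.apex_mem hD2,
      right_notMem_interior_sector hD2, fun j h1 h2 => ?_,
      hS ▸ left_notMem_interior_sector hD2, notMem_interior_mono h.last_bd sector_subset, ?_⟩
    · have e1 : orient a P (p j) ≤ 0 := hP ▸ hc.apex_le i j (by omega) (by omega)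
      have e2 : orient a S (p j) ≤ 0 := by
        rcases h1.eq_or_lt with rfl | h1
        · rw [← hS, orient_self_right]
        · exact hS ▸ hc.apex_le (i + 1) j h1 (by omega)
      have e3 : orient P S (p j) ≤ 0 := by
        rw [hP, hS]
        exact hright_edge j i (by omega) (by omega)
      refine mem_sector.2 ⟨h.chain_mem j (by omega) h2, ?_, ?_⟩
      · rw [hcS]
        nlinarith [mul_nonneg (mul_pos hr0 (sub_pos.2 hθ1)).le (neg_nonneg.2 e2),
          mul_nonneg (sub_pos.2 hr1).le (neg_nonneg.2 e3)]
      · rw [hca]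
        nlinarith [mul_nonneg (mul_pos hr0 hθ0).le (neg_nonneg.2 e2),
          mul_nonneg (sub_pos.2 hr1).le (neg_nonneg.2 e1)]
    · rw [hKw, hw2]
      push_cast
      ring
  have hdisjY : ∀ {k l}, k ≠ l → Disjoint ({x ∈ Y | K x = k} : Finset Plane) {x ∈ Y | K x = l} :=
    fun hkl => Finset.disjoint_filter.2 fun x _ h1 h2 => hkl (h1.symm.trans h2)
  have h01 := hsplit0.union hsplit1 hmi.le (by omega)
    (interior_sector_inter_sector (ne_of_orient_neg hD0).2) (hdisjY (by decide))
  have hclosed : IsClosed (sector Q c a P ∩ sector Q c S a) :=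
    (isConvexPolygonalRegion_sector h.region hcQ h.apex_mem hPmem hD0).isClosed.inter
      (isConvexPolygonalRegion_sector h.region hcQ hSmem h.apex_mem hD2).isClosed
  have hempty₁ : interior (sector Q c P S ∩ sector Q c S a) = ∅ :=
    interior_sector_inter_sector (ne_of_orient_neg hD1).2
  have hempty₂ : interior (sector Q c S a ∩ sector Q c a P) = ∅ :=
    interior_sector_inter_sector (ne_of_orient_neg hD2).2
  have h012 := h01.union hsplit2 (by omega) (by omega) (by
    rw [Set.union_inter_distrib_right,
      interior_union_isClosed_of_interior_empty hclosed hempty₁, Set.inter_comm, hempty₂])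
    (Finset.disjoint_union_left.2 ⟨hdisjY (by decide), hdisjY (by decide)⟩)
  have hQ : sector Q c a P ∪ sector Q c P S ∪ sector Q c S a = Q := by
    refine Set.Subset.antisymm
      (Set.union_subset (Set.union_subset sector_subset sector_subset) sector_subset) fun x hx => ?_
    obtain ⟨k, hk⟩ := exists_mem_cone (a := -orient P S x) (p := orient a S x)
      (s := -orient a P x) hθ0.le hθ1.le hr1.le
    have := hcone hx hk
    fin_cases k
    · exact Or.inl (Or.inl this)
    · exact Or.inl (Or.inr this)
    · exact Or.inr this
  have hYY : ({x ∈ Y | K x = 0} ∪ {x ∈ Y | K x = 1} ∪ {x ∈ Y | K x = 2} : Finset Plane) = Y := by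
    rw [← Finset.filter_or, ← Finset.filter_or]
    refine Finset.filter_true_of_mem fun x _ => ?_
    generalize K x = k
    fin_cases k <;> simp
  rwa [hQ, hYY] at h012

end Steps

/-! ### Induction on the length of the chain -/

/-- Every piece can be split along its part of the chain. -/
theorem IsPiece.splits {a : Plane} {p : ℕ → Plane} {s : ℕ} {X : Finset Plane} {w : Plane → ℤ}
    (hc : ChainConfig a p s X w) {Q : Set Plane} {m n : ℕ} {Y : Finset Plane}
    (h : IsPiece a p s X w Q m n Y) : Splits p w Q m n Y := by
  induction hd : n - m using Nat.strong_induction_on generalizing Q m n Y with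
  | _ d ihd =>
  have ih : ∀ Q' m' n' Y', n' - m' < n - m → IsPiece a p s X w Q' m' n' Y' →
      Splits p w Q' m' n' Y' := fun Q' m' n' Y' hlt h' => ihd _ (hd ▸ hlt) h' rfl
  have hmn := h.lt
  rcases (Nat.succ_le_of_lt hmn).eq_or_lt with rfl | hlt
  · exact Splits.of_edge h.region (h.chain_mem m le_rfl (by omega)) h.first_bd
      (h.chain_mem (m + 1) (by omega) le_rfl) h.last_bd h.mem (by rw [h.total]; push_cast; ring)
  by_cases hex : ∃ i, m < i ∧ i < n ∧ leftWeight a (p i) w Y = (i : ℤ) - m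
  · obtain ⟨i, h1, h2, h3⟩ := hex
    exact h.splits_of_leftWeight_eq hc h1 h2 h3 ih
  push Not at hex
  by_cases hfirst : 1 < leftWeight a (p (m + 1)) w Y
  · exact h.splits_of_lt_leftWeight hc hlt hfirst ih
  obtain ⟨l, rfl⟩ : ∃ l, n = l + 1 := ⟨n - 1, by omega⟩
  by_cases hlast : leftWeight a (p l) w Y < (l : ℤ) - m
  · exact h.splits_of_leftWeight_lt hc (by omega) hlast ih
  -- the left weight is too small for the first inner vertex and too large for the last one
  obtain ⟨i, hi1, hi2, hi3, hi4⟩ : ∃ i, m < i ∧ i + 1 < l + 1 ∧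
      leftWeight a (p i) w Y < (i : ℤ) - m ∧ (i : ℤ) + 1 - m < leftWeight a (p (i + 1)) w Y := by
    by_contra hno
    push Not at hno
    have key : ∀ i, m + 1 ≤ i → i ≤ l → leftWeight a (p i) w Y < (i : ℤ) - m := by
      intro i hi
      induction i, hi using Nat.le_induction with
      | base =>
        intro _
        have := hex (m + 1) (by omega) (by omega)
        push_cast at this ⊢
        omega
      | succ i hi ihi =>
        intro hil
        have h1 := hno i (by omega) (by omega) (ihi (by omega))
        have h2 := hex (i + 1) (by omega) (by omega)
        push_cast at h2 ⊢
        omega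
    exact hlast (key l (by omega) le_rfl)
  exact h.splits_of_leftWeight_lt_of_lt hc hi1 hi2 hi3 hi4 ih

lemma InGeneralPosition.orient_ne_zero {S : Set Plane} (hS : InGeneralPosition S) {x y z : Plane}
    (hx : x ∈ S) (hy : y ∈ S) (hz : z ∈ S) (hxy : x ≠ y) (hyz : y ≠ z) (hxz : x ≠ z) :
    orient x y z ≠ 0 := fun h0 =>
  hS x hx y hy z hz hxy hyz hxz (collinear_of_orient_eq_zero hxy h0)

end ChainPartition

open ChainPartition
theorem lemma7
    (Q : Set Plane) (hQ : IsConvexPolygonalRegion Q)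
    (a : Plane) (haQ : a ∈ frontier Q)
    (s : ℕ) (hs : 1 ≤ s)
    (p : Fin (s + 1) → Plane) (hpQ : ∀ i, p i ∈ Q)
    (hp_first : p 0 ∈ frontier Q) (hp_last : p (Fin.last s) ∈ frontier Q)
    (ha_right : a ∈ rightHalfPlane (p 0) (p (Fin.last s)))
    -- `(a, p₁, …, pₛ₊₁)` is a convex polygon, where `a = p₁` and `a = pₛ₊₁` are allowed
    (hpoly : ((a = p 0 ∨ a = p (Fin.last s)) ∧ IsClockwiseConvexPolygon p) ∨
      IsClockwiseConvexPolygon (Fin.cons a p : Fin (s + 2) → Plane))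
    (B R : Finset Plane) (hBR : Disjoint B R)
    (hB : ∀ b ∈ B, b ∈ enclosedRegion Q p)
    (hB_new : ∀ b ∈ B, b ≠ a ∧ ∀ i, b ≠ p i)
    (hR : ∀ r ∈ R, r ∈ Q ∧ r ∉ enclosedRegion Q p)
    (hcard : (s : ℤ) = (B.card : ℤ) - (R.card : ℤ))
    (hgen : InGeneralPosition ((R : Set Plane) ∪ (B : Set Plane) ∪ ({a} ∪ Set.range p))) :
    ∃ (Qs : Fin s → Set Plane) (c : Plane → Fin s),
      IsConvexPartition Q Qs ∧
      (∀ i : Fin s, IsDiagonal (p i.castSucc) (p i.succ) (Qs i)) ∧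
      -- every coloured point is assigned to one region that contains it
      (∀ x, x ∈ B ∨ x ∈ R → x ∈ Qs (c x)) ∧
      ∀ i : Fin s,
        ((B.filter fun x => c x = i).card : ℤ) - ((R.filter fun x => c x = i).card : ℤ) = 1 := by
  classical
  have hinj : Function.Injective p := by
    rcases hpoly with h | h
    · exact h.2.1
    · intro i j hij
      exact Fin.succ_injective _ (h.1 (by simpa using hij))
  have hconv : ∀ i j k, i < j → j < k → orient (p i) (p j) (p k) < 0 := by
    rcases hpoly with h | h
    · exact h.2.2
    · intro i j k hij hjk
      simpa using h.2 i.succ j.succ k.succ (Fin.succ_lt_succ_iff.2 hij) (Fin.succ_lt_succ_iff.2 hjk)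
  have hapex_lt : ∀ i j, i < j → a ≠ p i → a ≠ p j → orient a (p i) (p j) < 0 := by
    intro i j hij hi hj
    rcases hpoly with ⟨rfl | rfl, -⟩ | h
    · exact hconv 0 i j (Fin.pos_of_ne_zero fun h0 => hi (by rw [h0])) hij
    · have h1 := hconv i j (Fin.last s) hij (Fin.lt_last_iff_ne_last.2 fun h0 => hj (by rw [h0]))
      have h2 : orient (p (Fin.last s)) (p i) (p j) = orient (p i) (p j) (p (Fin.last s)) :=
      (orient_rotate _ _ _).symm
      rwa [h2]
    · simpa using h.2 0 i.succ j.succ (Fin.succ_pos i) (Fin.succ_lt_succ_iff.2 hij)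
  have hapex_ne : ∀ i, i ≠ 0 → i ≠ Fin.last s → a ≠ p i := by
    intro i h0 h1 hai
    rcases hpoly with ⟨rfl | rfl, -⟩ | h
    · exact h0 (hinj hai.symm)
    · exact h1 (hinj hai.symm)
    · exact Fin.succ_ne_zero i (h.1 (by simpa using hai.symm))
  -- no red point is the apex or a vertex, since these lie in the enclosed region
  have hR_new : ∀ r ∈ R, r ≠ a ∧ ∀ i, r ≠ p i := by
    have hpm : ∀ i, p i ∈ enclosedRegion Q p := by
      refine fun i => ⟨hpQ i, fun k => ?_⟩
      rw [mem_rightHalfPlane]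
      rcases lt_trichotomy i k.castSucc with h | h | h
      · have h1 := hconv i k.castSucc k.succ h (Fin.castSucc_lt_succ)
        have h2 : orient (p k.castSucc) (p k.succ) (p i) =
            orient (p i) (p k.castSucc) (p k.succ) :=
      orient_rotate _ _ _
        linarith
      · rw [h]; exact (orient_self_outer _ _).le
      · rcases (Fin.castSucc_lt_iff_succ_le.1 h).eq_or_lt with h | h
        · rw [← h]; exact (orient_self_right _ _).le
        · exact (hconv _ _ _ (Fin.castSucc_lt_succ) h).le
    refine fun r hr => ⟨?_, fun i h => (hR r hr).2 (h ▸ hpm i)⟩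
    rintro rfl
    by_cases hex : ∃ i, r = p i
    · obtain ⟨i, rfl⟩ := hex
      exact (hR _ hr).2 (hpm i)
    · push Not at hex
      refine (hR _ hr).2 ⟨(hR _ hr).1, fun k => ?_⟩
      have h1 := hapex_lt k.castSucc k.succ (Fin.castSucc_lt_succ) (hex _) (hex _)
      have h2 : orient (p k.castSucc) (p k.succ) r = orient r (p k.castSucc) (p k.succ) :=
      orient_rotate _ _ _
      rw [mem_rightHalfPlane]
      linarith
  set w : Plane → ℤ := fun x => if x ∈ B then 1 else -1 with hw
  have hwB : ∀ x ∈ B, w x = 1 := fun x hx => by simp [hw, hx]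
  have hwR : ∀ x ∈ R, w x = -1 := fun x hx => by
    simp [hw, Finset.disjoint_right.1 hBR hx]
  -- the chain, continued by its last point to a sequence indexed by `ℕ`
  set q : ℕ → Plane := fun j => p ⟨min j s, by omega⟩ with hq
  have hqp : ∀ j (hj : j ≤ s), q j = p ⟨j, by omega⟩ := fun j hj => by simp [hq, hj]
  have hXgen : ∀ x ∈ B ∪ R, x ∈ (R : Set Plane) ∪ (B : Set Plane) ∪ ({a} ∪ Set.range p) := by
    intro x hx
    rcases Finset.mem_union.1 hx with h | h
    · exact Or.inl (Or.inr h)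
    · exact Or.inl (Or.inl h)
  have haS : a ∈ (R : Set Plane) ∪ (B : Set Plane) ∪ ({a} ∪ Set.range p) :=
    Or.inr (Or.inl rfl)
  have hpS : ∀ i, p i ∈ (R : Set Plane) ∪ (B : Set Plane) ∪ ({a} ∪ Set.range p) :=
    fun i => Or.inr (Or.inr ⟨i, rfl⟩)
  have hnew : ∀ x ∈ B ∪ R, x ≠ a ∧ ∀ i, x ≠ p i := by
    intro x hx
    rcases Finset.mem_union.1 hx with h | h
    · exact hB_new x h
    · exact hR_new x h
  have hedge : ∀ x ∈ B ∪ R, ∀ k : Fin s, orient (p k.castSucc) (p k.succ) x ≠ 0 := fun x hx k =>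
    hgen.orient_ne_zero (hpS _) (hpS _) (hXgen x hx)
      (hinj.ne (Fin.castSucc_lt_succ).ne) ((hnew x hx).2 _).symm ((hnew x hx).2 _).symm
  have hXQ : ∀ x ∈ B ∪ R, x ∈ Q := by
    intro x hx
    rcases Finset.mem_union.1 hx with h | h
    · exact (hB x h).1
    · exact (hR x h).1
  have hconfig : ChainConfig a q s (B ∪ R) w := by
    refine ⟨fun i j k hij hjk hk => ?_, fun i j hij hj => ?_, fun i j hij hj hi hj' => ?_,
      fun i h0 hi => ?_, fun x hx => ?_, fun x hx hwx k hk => ?_, fun x hx hwx => ?_,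
      fun x hx y hy hxy => ?_, fun x hx y hy hxy i hi => ?_, fun x hx i hi => ?_,
      fun x hx i hi hai => ?_⟩
    · rw [hqp i (by omega), hqp j (by omega), hqp k hk]
      exact hconv _ _ _ (Fin.mk_lt_mk.2 hij) (Fin.mk_lt_mk.2 hjk)
    · rw [hqp i (by omega), hqp j hj]
      by_cases h1 : a = p ⟨i, by omega⟩
      · rw [← h1, orient_self_left]
      by_cases h2 : a = p ⟨j, by omega⟩
      · rw [← h2, orient_self_outer]
      exact (hapex_lt _ _ (Fin.mk_lt_mk.2 hij) h1 h2).le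
    · rw [hqp i (by omega)] at hi ⊢
      rw [hqp j hj] at hj' ⊢
      exact hapex_lt _ _ (Fin.mk_lt_mk.2 hij) hi hj'
    · rw [hqp i hi.le]
      refine hapex_ne _ (fun h => ?_) fun h => ?_
      · have := congrArg Fin.val h
        simp at this
        omega
      · have := congrArg Fin.val h
        simp at this
        omega
    · rcases Finset.mem_union.1 hx with h | h
      · exact Or.inl (hwB x h)
      · exact Or.inr (hwR x h)
    · have hxB : x ∈ B := by
        by_contra hxB
        simp [hw, hxB] at hwx
      rw [hqp k (by omega), hqp (k + 1) hk]
      exact lt_of_le_of_ne ((hB x hxB).2 ⟨k, by omega⟩) (hedge x hx ⟨k, by omega⟩)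
    · have hxR : x ∈ R := by
        refine (Finset.mem_union.1 hx).resolve_left fun hxB => ?_
        rw [hwB x hxB] at hwx
        norm_num at hwx
      have h1 := (hR x hxR).2
      simp only [enclosedRegion, Set.mem_ofPred_eq, not_and, not_forall] at h1
      obtain ⟨k, hk⟩ := h1 (hR x hxR).1
      refine ⟨k, k.2, ?_⟩
      rw [hqp k k.2.le, hqp (k + 1) k.2]
      exact not_le.1 hk
    · exact hgen.orient_ne_zero haS (hXgen x hx) (hXgen y hy) (hnew x hx).1.symm hxy
        (hnew y hy).1.symm
    · exact hgen.orient_ne_zero (hpS _) (hXgen x hx) (hXgen y hy) ((hnew x hx).2 _).symm hxy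
        ((hnew y hy).2 _).symm
    · rw [hqp i (by omega), hqp (i + 1) hi]
      exact hedge x hx ⟨i, by omega⟩
    · exact hgen.orient_ne_zero haS (hpS _) (hXgen x hx) hai ((hnew x hx).2 _).symm
        (hnew x hx).1.symm
  have hpiece : IsPiece a q s (B ∪ R) w Q 0 s (B ∪ R) := by
    refine ⟨hQ, hs, le_rfl, subset_rfl, hXQ, hQ.isClosed.frontier_subset haQ, haQ.2,
      fun j _ _ => hpQ _, ?_, ?_, ?_⟩
    · rw [hqp 0 (by omega)]; exact hp_first.2
    · rw [hqp s le_rfl]; exact hp_last.2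
    · rw [Finset.sum_union hBR, Finset.sum_congr rfl hwB, Finset.sum_congr rfl hwR, hcard]
      simp
      ring
  obtain ⟨Qs, c, hreg, hun, hdis, hass, hone⟩ := hpiece.splits hconfig
  have hlt : ∀ x ∈ B ∪ R, c x < s := fun x hx => (hass x hx).2.1
  have hcval : ∀ x ∈ B ∪ R, ∀ i : Fin s,
      (if h : c x < s then (⟨c x, h⟩ : Fin s) else ⟨0, hs⟩) = i ↔ c x = i := by
    intro x hx i
    rw [dif_pos (hlt x hx), Fin.ext_iff]
  refine ⟨fun i => Qs i, fun x => if h : c x < s then ⟨c x, h⟩ else ⟨0, hs⟩,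
    ⟨fun i => (hreg i (Nat.zero_le _) i.2).1, ?_, ?_⟩, ?_, ?_, ?_⟩
  · ext x
    rw [hun, Set.mem_iUnion]
    exact ⟨fun ⟨i, hx⟩ => ⟨i, Nat.zero_le _, i.2, hx⟩, fun ⟨j, _, hj, hx⟩ => ⟨⟨j, hj⟩, hx⟩⟩
  · intro i j hij
    rcases lt_or_gt_of_ne (Fin.val_ne_of_ne hij) with h | h
    · exact hdis i j (Nat.zero_le _) h j.2
    · exact (hdis j i (Nat.zero_le _) h i.2).symm
  · intro i
    obtain ⟨-, h1, h2⟩ := hreg i (Nat.zero_le _) i.2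
    rw [hqp i i.2.le] at h1
    rw [hqp (i + 1) i.2] at h2
    exact ⟨hinj.ne (Fin.castSucc_lt_succ).ne, ⟨subset_closure h1.1, h1.2⟩, subset_closure h2.1,
      h2.2⟩
  · intro x hx
    have hx' : x ∈ B ∪ R := Finset.mem_union.2 hx
    simp only [dif_pos (hlt x hx')]
    exact (hass x hx').2.2
  · intro i
    have h1 := hone i (Nat.zero_le _) i.2
    rw [Finset.filter_union, Finset.sum_union (Finset.disjoint_filter_filter hBR),
      Finset.sum_congr rfl fun x hx => hwB x (Finset.mem_filter.1 hx).1,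
      Finset.sum_congr rfl fun x hx => hwR x (Finset.mem_filter.1 hx).1] at h1
    rw [Finset.filter_congr fun x hx => hcval x (Finset.mem_union_left R hx) i,
      Finset.filter_congr fun x hx => hcval x (Finset.mem_union_right B hx) i]
    simpa [sub_eq_add_neg] using h1
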